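/- Stochastic online bin packing with i.i.d. arrivals. Fix a bin size $B$ and a probability distribution $p$ on item sizes $[B]=\{1,\dots,B\}$. A state is $s=(x,u)$, where $x=(x_1,\dots,x_B)\in\mathbb{N}^B$ counts the open bins of utilization $1,\dots,B$ and $u\in[B]$ is the size of the current item. The actions are $a\in\{0,1,\dots,B\}$: $a=0$ opens a new bin for the item (reward $r=-1$, and $x_u$ increases by one); $a>0$ puts the item into an open bin of utilization $a$, which is feasible if $x_a>0$ and $a+u\le B$ (reward $r=0$, $x_a$ decreases by one and $x_{a+u}$ increases by one); an infeasible action has reward $r=-100$ and leaves $x$ unchanged. Over the rounds $t=1,\dots,T$ the action $a_t$ is chosen in state $s_t=(x_t,\xi_{t-1})$; then $\xi_t$ is revealed and becomes the current item, $s_{t+1}=f(s_t,a_t,\xi_t)=(x_{t+1},\xi_t)$, where $\xi_1,\dots,\xi_T$ are i.i.d. with law $p$ and the starting state $s_1$ is given. For a (possibly randomized and time-dependent) Markov policy $\pi$ let $V^\pi_t(s)$ and $Q^\pi_t(s,a)$ be the expected total rewards over rounds $t,\dots,T$ from $s_t=s$, respectively from $s_t=s$, $a_t=a$ and following $\pi$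 afterwards. Let $\pi^\star$ be a deterministic policy that maximizes $V^\pi_t(s)$ over all such $\pi$, for all $t\in[T]$ and $s$, and put $V^\star=V^{\pi^\star}$, $Q^\star=Q^{\pi^\star}$. Let $\textsc{Hindsight}(t,\boldsymbol\xi_{\ge t},s)$ be the maximal total reward over rounds $t,\dots,T$ from $s_t=s$, over all action sequences $(a_t,\dots,a_T)$, when the trace $\boldsymbol\xi_{\ge t}=(\xi_t,\dots,\xi_T)$ is known (it is $0$ for $t=T+1$). Put $$Q^\dagger_t(s,a)=\mathbb{E}_{\boldsymbol\xi_{\ge t}}\big[r(s,a)+\textsc{Hindsight}(t+1,\boldsymbol\xi_{>t},f(s,a,\xi_t))\big],\qquad \pi^\dagger_t(s)\in\arg\max_a Q^\dagger_t(s,a),$$ $$\Delta^\dagger_t(s)=Q^\dagger_t(s,\pi^\dagger_t(s))-Q^\star_t(s,\pi^\dagger_t(s))+Q^\star_t(s,\pi^\star_t(s))-Q^\dagger_t(s,\pi^\star_t(s)),$$ $$\textsc{Regret}(\pi)=V^\star_1(s_1)-V^\pi_1(s_1).$$ Theorem. For every $B$ and $p$, and with any choice of the maximizers $\pi^\dagger$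 and $\pi^\star$: (i) $\Delta^\dagger_t(s)\le 3$ for every horizon $T$, every $t\in[T]$ and every state $s$ (an absolute constant, independent of $T$, $B$ and $p$). (ii) As a result, $\textsc{Regret}(\pi^\dagger)=O(1)$: there is a constant $C=C(B,p)$ such that $\textsc{Regret}(\pi^\dagger)\le C$ for every horizon $T$ and every starting state $s_1$. -/

import Mathlib

/-- The integers `1, …, B`: the possible item sizes, and the possible utilizations of an open bin. -/
abbrev BinSize (B : ℕ) : Type := {n : ℕ // n ∈ Finset.Icc 1 B}

/-- `none` (the action `0`) opens a new bin for the current item, `some ℓ` puts the current item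
into an open bin of utilization `ℓ`. -/
abbrev BinAction (B : ℕ) : Type := Option (BinSize B)

/-- A state `s_t = (x_t, ξ_{t-1})`: `bins ℓ` is the number of open bins of utilization `ℓ`, and
`item` is the size of the item that has to be packed now. -/
@[ext]
structure BinState (B : ℕ) where
  bins : BinSize B → ℕ
  item : BinSize B

namespace BinState

variable {B : ℕ}

/-- There is an open bin of utilization `ℓ`, and the current item fits into it. -/
def Fits (s : BinState B) (ℓ : BinSize B) : Prop :=
  0 < s.bins ℓ ∧ (ℓ : ℕ) + (s.item : ℕ) ≤ B

instance (s : BinState B) (ℓ : BinSize B) : Decidable (s.Fits ℓ) :=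
  inferInstanceAs (Decidable (_ ∧ _))

/-- The utilization of a bin of utilization `ℓ` after the current item has been added. -/
def filled (s : BinState B) (ℓ : BinSize B) (h : s.Fits ℓ) : BinSize B :=
  ⟨(ℓ : ℕ) + (s.item : ℕ), Finset.mem_Icc.2
    ⟨le_trans (Finset.mem_Icc.1 ℓ.2).1 (Nat.le_add_right _ _), h.2⟩⟩

/-- The transition: `ξ` is the next item, revealed after the action. An infeasible action leaves
the bins as they are. -/
def next (s : BinState B) (a : BinAction B) (ξ : BinSize B) : BinState B :=
  match a with
  | none => ⟨s.bins + Pi.single s.item 1, ξ⟩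
  | some ℓ =>
    if h : s.Fits ℓ then ⟨s.bins - Pi.single ℓ 1 + Pi.single (s.filled ℓ h) 1, ξ⟩
    else ⟨s.bins, ξ⟩

/-- The reward: `-1` for a new bin, `0` for a feasible use of an open bin, `-100` otherwise. -/
noncomputable def reward (s : BinState B) (a : BinAction B) : ℝ :=
  match a with
  | none => -1
  | some ℓ => if s.Fits ℓ then 0 else -100

end BinState

section Values

variable {B : ℕ}

/-- Expectation of `g (ξ₀, …, ξ_{n-1})` for i.i.d. inputs with probability vector `p`. -/
noncomputable def traceExp (p : BinSize B → ℝ) (n : ℕ) (g : (Fin n → BinSize B) → ℝ) : ℝ :=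
  ∑ ξ : Fin n → BinSize B, (∏ i, p (ξ i)) * g ξ

/-- Total reward of the action sequence `a` from state `s` along the trace `ξ` (`n` periods). -/
noncomputable def openLoopReturn :
    (n : ℕ) → BinState B → (Fin n → BinAction B) → (Fin n → BinSize B) → ℝ
  | 0, _, _, _ => 0
  | n + 1, s, a, ξ =>
    s.reward (a 0) + openLoopReturn n (s.next (a 0) (ξ 0)) (Fin.tail a) (Fin.tail ξ)

/-- The hindsight planner: the largest total reward of an action sequence over the `n` remaining
periods when the trace `ξ` is known (a maximum over a finite nonempty set). -/
noncomputable def hindsight (n : ℕ) (s : BinState B) (ξ : Fin n → BinSize B) : ℝ :=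
  ⨆ a : Fin n → BinAction B, openLoopReturn n s a ξ

/-- `Q†_t(s, a)` for horizon `T`; at time `t ∈ {1, …, T}` the inputs `ξ_t, …, ξ_T` are still
unknown, and `T - t` periods follow the present one. -/
noncomputable def hindsightQ (p : BinSize B → ℝ) (T t : ℕ) (s : BinState B) (a : BinAction B) : ℝ :=
  traceExp p (T - t + 1) fun ξ =>
    s.reward a + hindsight (T - t) (s.next a (ξ 0)) (Fin.tail ξ)

/-- Non-anticipatory (randomized, time-dependent) Markov policies. -/
abbrev MarkovPolicy (B : ℕ) : Type := ℕ → BinState B → stdSimplex ℝ (BinAction B)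

/-- Deterministic Markov policies. -/
abbrev DetPolicy (B : ℕ) : Type := ℕ → BinState B → BinAction B

/-- A deterministic policy as a Markov policy. -/
noncomputable def DetPolicy.toMarkov (π : DetPolicy B) : MarkovPolicy B :=
  fun t s => ⟨Pi.single (π t s) 1, single_mem_stdSimplex ℝ (π t s)⟩

/-- `V^π_t(s, ξ)`: expected total reward of `π` over `n` periods, starting from `s` at time `t`,
along a fixed trace `ξ`; the expectation is over the randomization of `π` only. -/
noncomputable def traceValue (π : MarkovPolicy B) :
    (t n : ℕ) → BinState B → (Fin n → BinSize B) → ℝ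
  | _, 0, _, _ => 0
  | t, n + 1, s, ξ =>
    ∑ a, (π t s : BinAction B → ℝ) a *
      (s.reward a + traceValue π (t + 1) n (s.next a (ξ 0)) (Fin.tail ξ))

/-- `V^π_t(s)` for horizon `T` (`1 ≤ t ≤ T + 1`). -/
noncomputable def policyV (p : BinSize B → ℝ) (T : ℕ) (π : MarkovPolicy B) (t : ℕ)
    (s : BinState B) : ℝ :=
  traceExp p (T + 1 - t) fun ξ => traceValue π t (T + 1 - t) s ξ

/-- `Q^π_t(s, a)` for horizon `T` (`1 ≤ t ≤ T`). -/
noncomputable def policyQ (p : BinSize B → ℝ) (T : ℕ) (π : MarkovPolicy B) (t : ℕ)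
    (s : BinState B) (a : BinAction B) : ℝ :=
  traceExp p (T - t + 1) fun ξ =>
    s.reward a + traceValue π (t + 1) (T - t) (s.next a (ξ 0)) (Fin.tail ξ)

/-- `π†_t(s) ∈ argmax_a Q†_t(s, a)` for every `t ∈ {1, …, T}` and every state `s`. -/
def IsHindsightPolicy (p : BinSize B → ℝ) (T : ℕ) (dag : DetPolicy B) : Prop :=
  ∀ t ∈ Finset.Icc 1 T, ∀ s a, hindsightQ p T t s a ≤ hindsightQ p T t s (dag t s)

/-- `π⋆` maximizes `V^π_t(s)` over all Markov policies, at every `t ∈ {1, …, T}` and state `s`. -/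
def IsOptimalPolicy (p : BinSize B → ℝ) (T : ℕ) (opt : DetPolicy B) : Prop :=
  ∀ t ∈ Finset.Icc 1 T, ∀ (s : BinState B) (π : MarkovPolicy B),
    policyV p T π t s ≤ policyV p T opt.toMarkov t s

/-- The hindsight bias
`Δ†_t(s) = Q†_t(s, π†(s)) - Q⋆_t(s, π†(s)) + Q⋆_t(s, π⋆(s)) - Q†_t(s, π⋆(s))`. -/
noncomputable def hindsightBias (p : BinSize B → ℝ) (T : ℕ) (dag opt : DetPolicy B) (t : ℕ)
    (s : BinState B) : ℝ :=
  hindsightQ p T t s (dag t s) - policyQ p T opt.toMarkov t s (dag t s)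
    + policyQ p T opt.toMarkov t s (opt t s) - hindsightQ p T t s (opt t s)

/-- `Regret(π) = V⋆_1(s₁) - V^π_1(s₁)`, with `V⋆` the value of the optimal policy `opt`. -/
noncomputable def regret (p : BinSize B → ℝ) (T : ℕ) (opt : DetPolicy B) (π : MarkovPolicy B)
    (s₁ : BinState B) : ℝ :=
  policyV p T opt.toMarkov 1 s₁ - policyV p T π 1 s₁

end Values

/-! For the bias, the hindsight value along a trace and the optimal expected value are instances of
one dynamic program with independent inputs, `dpValue`: the laws are point masses in the first case
and copies of `p` in the second. An imitation argument shows there that an extra open bin is worth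
between 0 and 1 and that an emptier bin is at least as good as a fuller one. So, compared with
untouched bins, opening a bin moves the continuation value by an amount in [0, 1] and any other
action by an amount in [-1, 0]. Immediate rewards cancel in the bias, and what remains is at most 2
(`hindsightBias_le_two`).

For the regret, the hindsight value does not depend on the order of the items: it is minus the
optimum of an integer program whose columns are the ways to use one bin and whose right-hand side
counts open bins and items. Optimal solutions of such a program can be chosen stably under changes
of the right-hand side (`Matrix.exists_isIPOptimal_near`). If the current size has positive
probability, a typical trace contains linearly many items of that size, so in an optimal packing for
a reference trace some pattern containing it carries linearly much mass. By stability that pattern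
survives in an optimal packing for every trace with similar frequencies. Its initial bin is thus an
action, chosen without knowledge of the trace, that loses nothing on all of them
(`exists_action_hindsight_stable`).

Atypical traces have exponentially small probability and cost at most 102 each, so the expected
one-step loss is geometric in the remaining time. A maximizer of the hindsight Q-value loses no more
in expectation than this action. Summing the losses bounds the gap to the hindsight planner, which
dominates every policy. -/

open Matrix

/-! ### Stability of integer programs in the right-hand side. -/

section IntegerProgramming

variable {ι κ : Type*} [Fintype ι]

/-- `p` and `q` dominate no nonzero pair with equal images under `A`. -/
def Matrix.KernelFree (A : Matrix κ ι ℕ) (p q : ι → ℕ) : Prop :=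
  ∀ p' ≤ p, ∀ q' ≤ q, A *ᵥ p' = A *ᵥ q' → p' = 0 ∧ q' = 0

theorem Matrix.KernelFree.mono {A : Matrix κ ι ℕ} {p q p₁ q₁ : ι → ℕ} (h : A.KernelFree p q)
    (hp : p₁ ≤ p) (hq : q₁ ≤ q) : A.KernelFree p₁ q₁ :=
  fun p' hp' q' hq' => h p' (hp'.trans hp) q' (hq'.trans hq)

/-- The quadruples `(p, q, d, e)` with `A (p - q) = d - e`. -/
def Matrix.differenceSubmonoid (A : Matrix κ ι ℕ) :
    AddSubmonoid (((ι → ℕ) × (ι → ℕ)) × ((κ → ℕ) × (κ → ℕ))) where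
  carrier := {v | A *ᵥ v.1.1 + v.2.2 = A *ᵥ v.1.2 + v.2.1}
  zero_mem' := by simp
  add_mem' := by
    intro v w hv hw
    simp only [Set.mem_ofPred_eq, Prod.fst_add, Prod.snd_add, mulVec_add] at *
    rw [add_add_add_comm, hv, hw, add_add_add_comm]

/-- A linear equation defines these quadruples, so differences that exist over the naturals stay
inside; subtractive submonoids are finitely generated. -/
theorem Matrix.differenceSubmonoid_fg [Finite κ] (A : Matrix κ ι ℕ) : A.differenceSubmonoid.FG := by
  refine AddSubmonoid.fg_of_subtractive fun v hv w hw => ?_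
  simp only [differenceSubmonoid, AddSubmonoid.mem_mk, AddSubsemigroup.mem_mk, Set.mem_ofPred_eq,
    Prod.fst_add, Prod.snd_add, mulVec_add] at *
  rw [add_add_add_comm, add_add_add_comm (A *ᵥ v.1.2), hv] at hw
  exact add_left_cancel hw

/-- Decompose `(p, q, d, e)` into finitely many types of generators. Kernel-freeness passes to
summands, and both sides of the bound are additive, so generators suffice. -/
theorem Matrix.exists_kernelFree_bound [Fintype κ] (A : Matrix κ ι ℕ) :
    ∃ K : ℕ, ∀ (p q : ι → ℕ) (d e : κ → ℕ), A *ᵥ p + e = A *ᵥ q + d → A.KernelFree p q →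
      ∑ i, p i + ∑ i, q i ≤ K * (∑ k, d k + ∑ k, e k) := by
  obtain ⟨S, hS⟩ := A.differenceSubmonoid_fg
  obtain ⟨K, hK⟩ : ∃ K : ℕ, ∀ v ∈ S, ∑ i, v.1.1 i + ∑ i, v.1.2 i ≤ K :=
    ⟨S.sup fun v => ∑ i, v.1.1 i + ∑ i, v.1.2 i, fun v hv =>
      Finset.le_sup (f := fun v => ∑ i, v.1.1 i + ∑ i, v.1.2 i) hv⟩
  refine ⟨K, fun p q d e h hfree => ?_⟩
  suffices key : ∀ v : ((ι → ℕ) × (ι → ℕ)) × ((κ → ℕ) × (κ → ℕ)),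
      v ∈ AddSubmonoid.closure (S : Set (((ι → ℕ) × (ι → ℕ)) × ((κ → ℕ) × (κ → ℕ)))) →
      A.KernelFree v.1.1 v.1.2 →
      ∑ i, v.1.1 i + ∑ i, v.1.2 i ≤ K * (∑ k, v.2.1 k + ∑ k, v.2.2 k) from
    key ((p, q), (d, e)) (hS ▸ h) hfree
  intro v hv
  induction hv using AddSubmonoid.closure_induction with
  | mem v hv =>
    intro hfree
    have hvA : v ∈ A.differenceSubmonoid := hS ▸ AddSubmonoid.subset_closure hv
    -- A generator with `d = e = 0` is a kernel pair and hence zero; for any other one the right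
    -- side is at least `K`.
    rcases Nat.eq_zero_or_pos (∑ k, v.2.1 k + ∑ k, v.2.2 k) with h0 | h0
    · have hd : v.2.1 = 0 := by ext k; simp_all
      have he : v.2.2 = 0 := by ext k; simp_all
      have hker : A *ᵥ v.1.1 = A *ᵥ v.1.2 := by
        simpa [differenceSubmonoid, hd, he] using hvA
      obtain ⟨h1, h2⟩ := hfree _ le_rfl _ le_rfl hker
      simp [h1, h2]
    · exact (hK v hv).trans (Nat.le_mul_of_pos_right _ h0)
  | zero => simp
  | add v w _ _ ihv ihw =>
    intro hfree
    have h1 := ihv (hfree.mono le_self_add le_self_add)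
    have h2 := ihw (hfree.mono le_add_self le_add_self)
    simp only [Prod.fst_add, Prod.snd_add, Pi.add_apply, Finset.sum_add_distrib]
    linarith

/-- `z` is a solution of the integer program `min c ⬝ᵥ z`, `A *ᵥ z = b`. -/
def Matrix.IsIPOptimal (A : Matrix κ ι ℕ) (c : ι → ℕ) (b : κ → ℕ) (z : ι → ℕ) : Prop :=
  A *ᵥ z = b ∧ ∀ w, A *ᵥ w = b → c ⬝ᵥ z ≤ c ⬝ᵥ w

theorem Matrix.exists_isIPOptimal {A : Matrix κ ι ℕ} (c : ι → ℕ) {b : κ → ℕ} {w : ι → ℕ}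
    (hw : A *ᵥ w = b) : ∃ z, A.IsIPOptimal c b z := by
  have hwf : WellFounded fun v w : ι → ℕ => c ⬝ᵥ v < c ⬝ᵥ w := InvImage.wf _ wellFounded_lt
  obtain ⟨z, hz, hmin⟩ := hwf.has_min {z | A *ᵥ z = b} ⟨w, hw⟩
  exact ⟨z, hz, fun v hv => not_lt.1 (hmin v hv)⟩

/-- Stability of integer programs: an optimal solution for one right-hand side has an optimal
solution for another one at a distance that is linear in the distance of the right-hand sides. -/
theorem Matrix.exists_isIPOptimal_near [Fintype κ] (A : Matrix κ ι ℕ) (c : ι → ℕ) :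
    ∃ K : ℕ, ∀ (b b' : κ → ℕ) (z w : ι → ℕ), A.IsIPOptimal c b z → A *ᵥ w = b' →
      ∃ z', A.IsIPOptimal c b' z' ∧ ∀ i, z i ≤ z' i + K * ∑ k, ((b k - b' k) + (b' k - b k)) := by
  obtain ⟨K, hK⟩ := A.exists_kernelFree_bound
  refine ⟨K, fun b b' z w hz hw => ?_⟩
  obtain ⟨z₀, hz₀⟩ := exists_isIPOptimal c hw
  -- Among the optimal solutions for `b'`, the one nearest to `z` in the ℓ¹ distance is taken. A
  -- kernel pair inside `z' - z` and `z - z'` could be exchanged to bring it even nearer.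
  have hwf : WellFounded fun v w : ι → ℕ =>
      ∑ i, ((v i - z i) + (z i - v i)) < ∑ i, ((w i - z i) + (z i - w i)) :=
    InvImage.wf (fun v : ι → ℕ => ∑ i, ((v i - z i) + (z i - v i))) wellFounded_lt
  obtain ⟨z', hz', hmin⟩ := hwf.has_min {z' | A.IsIPOptimal c b' z'} ⟨z₀, hz₀⟩
  refine ⟨z', hz', fun i => ?_⟩
  have hfree : A.KernelFree (z' - z) (z - z') := by
    intro p hp q hq hpq
    have hp' : ∀ i, p i ≤ z' i - z i := hp
    have hq' : ∀ i, q i ≤ z i - z' i := hq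
    obtain ⟨y, hy⟩ : ∃ y, y + q = z + p :=
      ⟨z + p - q, by ext i; have := hq' i; simp only [Pi.add_apply, Pi.sub_apply]; omega⟩
    obtain ⟨y', hy'⟩ : ∃ y', y' + p = z' + q :=
      ⟨z' + q - p, by ext i; have := hp' i; simp only [Pi.add_apply, Pi.sub_apply]; omega⟩
    have hyA : A *ᵥ y = b := by
      have := congrArg (A *ᵥ ·) hy
      simp only [mulVec_add, hpq, hz.1] at this
      exact add_right_cancel this
    have hyA' : A *ᵥ y' = b' := by
      have := congrArg (A *ᵥ ·) hy'
      simp only [mulVec_add, hpq, hz'.1] at this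
      exact add_right_cancel this
    have hc := congrArg (c ⬝ᵥ ·) hy
    have hc' := congrArg (c ⬝ᵥ ·) hy'
    simp only [dotProduct_add] at hc hc'
    have h1 := hz.2 y hyA
    -- Optimality of `z` against `y` gives `c ⬝ᵥ q ≤ c ⬝ᵥ p`, so the exchange does not raise the
    -- cost of `z'`.
    have hopt : A.IsIPOptimal c b' y' := ⟨hyA', fun v hv => by have := hz'.2 v hv; omega⟩
    have hle := not_lt.1 (hmin y' hopt)
    have hpt : ∀ i, (y' i - z i) + (z i - y' i) + (p i + q i) ≤ (z' i - z i) + (z i - z' i) := by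
      intro i
      have h1 := hp' i
      have h2 := hq' i
      have h3 : y' i + p i = z' i + q i := congrFun hy' i
      omega
    have hsum := Finset.sum_le_sum fun i (_ : i ∈ Finset.univ) => hpt i
    rw [Finset.sum_add_distrib] at hsum
    have h0 : ∑ i, (p i + q i) = 0 := by omega
    simp only [Finset.sum_eq_zero_iff, Finset.mem_univ, true_implies, Nat.add_eq_zero_iff] at h0
    exact ⟨funext fun i => (h0 i).1, funext fun i => (h0 i).2⟩
  have hAdd : z' + (z - z') = z + (z' - z) := by
    ext i; simp only [Pi.add_apply, Pi.sub_apply]; omega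
  have hdiff : A *ᵥ (z' - z) + (b - b') = A *ᵥ (z - z') + (b' - b) := by
    have := congrArg (A *ᵥ ·) hAdd
    simp only [mulVec_add, hz.1, hz'.1] at this
    ext k
    have := congrFun this k
    simp only [Pi.add_apply, Pi.sub_apply] at this ⊢
    omega
  have hbound := hK _ _ _ _ hdiff hfree
  have hi : (z - z') i ≤ ∑ i, (z - z') i :=
    Finset.single_le_sum (f := (z - z')) (fun _ _ => Nat.zero_le _) (Finset.mem_univ i)
  have hswap : ∑ k, (b' - b) k + ∑ k, (b - b') k = ∑ k, ((b k - b' k) + (b' k - b k)) := by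
    rw [Finset.sum_add_distrib, add_comm]; rfl
  rw [hswap] at hbound
  simp only [Pi.sub_apply] at hi hbound
  omega

end IntegerProgramming

/-! ### Transitions and rewards, action by action. -/

namespace BinState

variable {B : ℕ}

/-- Bins in the form `y + Pi.single ℓ 1` make the transition free of truncated subtraction. -/
theorem fits_iff {s : BinState B} {ℓ : BinSize B} :
    s.Fits ℓ ↔ (∃ y : BinSize B → ℕ, s.bins = y + Pi.single ℓ 1) ∧ (ℓ : ℕ) + (s.item : ℕ) ≤ B := by
  refine and_congr_left fun _ => ⟨fun h => ⟨s.bins - Pi.single ℓ 1, ?_⟩, ?_⟩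
  · ext k
    rcases eq_or_ne k ℓ with rfl | hk
    · simp only [Pi.add_apply, Pi.sub_apply, Pi.single_eq_same]; omega
    · simp [hk]
  · rintro ⟨y, hy⟩
    simp [hy]

/-- The utilization `k + u` of a bin of utilization `k` into which `u` has been put. -/
def addSize (k u : BinSize B) (h : (k : ℕ) + u ≤ B) : BinSize B :=
  ⟨(k : ℕ) + u, Finset.mem_Icc.2 ⟨le_add_right (Finset.mem_Icc.1 k.2).1, h⟩⟩

theorem next_none (x : BinSize B → ℕ) (u ξ : BinSize B) :
    next ⟨x, u⟩ none ξ = ⟨x + Pi.single u 1, ξ⟩ := rfl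

theorem next_some (y : BinSize B → ℕ) (u k ξ : BinSize B) (h : (k : ℕ) + u ≤ B) :
    next ⟨y + Pi.single k 1, u⟩ (some k) ξ = ⟨y + Pi.single (addSize k u h) 1, ξ⟩ := by
  have hf : Fits ⟨y + Pi.single k 1, u⟩ k := fits_iff.2 ⟨⟨y, rfl⟩, h⟩
  simp only [next, dif_pos hf, add_tsub_cancel_right]
  rfl

theorem next_of_not_fits {s : BinState B} {k : BinSize B} (h : ¬ s.Fits k) (ξ : BinSize B) :
    s.next (some k) ξ = ⟨s.bins, ξ⟩ := by
  simp [next, h]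

theorem reward_none (s : BinState B) : s.reward none = -1 := rfl

theorem reward_some (y : BinSize B → ℕ) (u k : BinSize B) (h : (k : ℕ) + u ≤ B) :
    reward ⟨y + Pi.single k 1, u⟩ (some k) = 0 := by
  have hf : Fits ⟨y + Pi.single k 1, u⟩ k := fits_iff.2 ⟨⟨y, rfl⟩, h⟩
  simp [reward, hf]

theorem reward_of_not_fits {s : BinState B} {k : BinSize B} (h : ¬ s.Fits k) :
    s.reward (some k) = -100 := by
  simp [reward, h]

/-- A case distinction over the kinds of actions. -/
theorem action_cases (x : BinSize B → ℕ) (u : BinSize B) (a : BinAction B) :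
    a = none ∨ (∃ k, a = some k ∧ ¬ Fits ⟨x, u⟩ k) ∨
      ∃ (k : BinSize B) (y : BinSize B → ℕ), a = some k ∧ x = y + Pi.single k 1 ∧ (k : ℕ) + u ≤ B := by
  rcases a with _ | k
  · exact Or.inl rfl
  · by_cases h : Fits ⟨x, u⟩ k
    · obtain ⟨⟨y, hy⟩, hk⟩ := fits_iff.1 h
      exact Or.inr (Or.inr ⟨k, y, rfl, hy, hk⟩)
    · exact Or.inr (Or.inl ⟨k, rfl, h⟩)

end BinState

/-! ### The worth of an open bin in a dynamic program with independent inputs. -/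

section DynamicProgram

variable {B : ℕ}

theorem stdSimplex_expectation_le {α : Type*} [Fintype α] {p : α → ℝ} (hp : p ∈ stdSimplex ℝ α)
    {f g : α → ℝ} {c : ℝ} (h : ∀ i, f i ≤ g i + c) : ∑ i, p i * f i ≤ ∑ i, p i * g i + c := by
  calc ∑ i, p i * f i ≤ ∑ i, p i * (g i + c) :=
        Finset.sum_le_sum fun i _ => mul_le_mul_of_nonneg_left (h i) (hp.1 i)
    _ = ∑ i, p i * g i + c := by
        simp only [mul_add, Finset.sum_add_distrib, ← Finset.sum_mul, hp.2, one_mul]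

/-- The optimal value over `n` periods if the inputs are independent with laws `P 0, P 1, …`. -/
noncomputable def dpValue : (n : ℕ) → (Fin n → BinSize B → ℝ) → BinState B → ℝ
  | 0, _, _ => 0
  | n + 1, P, s => ⨆ a : BinAction B,
      (s.reward a + ∑ ξ, P 0 ξ * dpValue n (Fin.tail P) (s.next a ξ))

variable {n : ℕ}

theorem dpValue_ge (P : Fin (n + 1) → BinSize B → ℝ) (s : BinState B) (a : BinAction B) :
    s.reward a + ∑ ξ, P 0 ξ * dpValue n (Fin.tail P) (s.next a ξ) ≤ dpValue (n + 1) P s :=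
  le_ciSup (f := fun a => s.reward a + ∑ ξ, P 0 ξ * dpValue n (Fin.tail P) (s.next a ξ))
    (Set.finite_range _).bddAbove a

theorem exists_dpValue_eq (P : Fin (n + 1) → BinSize B → ℝ) (s : BinState B) :
    ∃ a, dpValue (n + 1) P s = s.reward a + ∑ ξ, P 0 ξ * dpValue n (Fin.tail P) (s.next a ξ) := by
  obtain ⟨a, ha⟩ := exists_eq_ciSup_of_finite
    (f := fun a => s.reward a + ∑ ξ, P 0 ξ * dpValue n (Fin.tail P) (s.next a ξ))
  exact ⟨a, ha.symm⟩

/-- To compare two states it is enough to answer every action at the first one. -/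
theorem dpValue_le_of_forall {P : Fin (n + 1) → BinSize B → ℝ}
    (hP : ∀ i, P i ∈ stdSimplex ℝ (BinSize B)) {s s' : BinState B} {c : ℝ}
    (h : ∀ a, ∃ a', ∀ ξ, s.reward a + dpValue n (Fin.tail P) (s.next a ξ) ≤
      s'.reward a' + dpValue n (Fin.tail P) (s'.next a' ξ) + c) :
    dpValue (n + 1) P s ≤ dpValue (n + 1) P s' + c := by
  obtain ⟨a, ha⟩ := exists_dpValue_eq P s
  obtain ⟨a', ha'⟩ := h a
  have h1 := dpValue_ge P s' a'
  have h2 := stdSimplex_expectation_le (hP 0) (c := s'.reward a' + c - s.reward a)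
    (f := fun ξ => dpValue n (Fin.tail P) (s.next a ξ))
    (g := fun ξ => dpValue n (Fin.tail P) (s'.next a' ξ)) fun ξ => by linarith [ha' ξ]
  linarith

/-- The better state imitates every action of the worse one. An infeasible action is answered by
opening a bin, since -1 exceeds -100 and the additional bin does no harm. -/
theorem dpValue_mono_aux (n : ℕ) (P : Fin n → BinSize B → ℝ)
    (hP : ∀ i, P i ∈ stdSimplex ℝ (BinSize B)) :
    (∀ (x : BinSize B → ℕ) (u k : BinSize B),
      dpValue n P ⟨x, u⟩ ≤ dpValue n P ⟨x + Pi.single k 1, u⟩) ∧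
    (∀ (x : BinSize B → ℕ) (u k k' : BinSize B), k ≤ k' →
      dpValue n P ⟨x + Pi.single k' 1, u⟩ ≤ dpValue n P ⟨x + Pi.single k 1, u⟩) := by
  induction n with
  | zero => simp [dpValue]
  | succ n ih =>
    obtain ⟨ih1, ih2⟩ := ih (Fin.tail P) fun i => hP i.succ
    constructor
    · intro x u k
      rw [← add_zero (dpValue _ _ ⟨x + _, u⟩)]
      refine dpValue_le_of_forall hP fun a => ?_
      rcases BinState.action_cases x u a with rfl | ⟨l, rfl, hl⟩ | ⟨l, y, rfl, rfl, hl⟩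
      · refine ⟨none, fun ξ => ?_⟩
        simp only [BinState.next_none, BinState.reward_none, add_right_comm x _ (Pi.single u 1)]
        linarith [ih1 (x + Pi.single u 1) ξ k]
      · refine ⟨none, fun ξ => ?_⟩
        simp only [BinState.next_none, BinState.reward_none, BinState.reward_of_not_fits hl,
          BinState.next_of_not_fits hl]
        linarith [ih1 x ξ k, ih1 (x + Pi.single k 1) ξ u]
      · refine ⟨some l, fun ξ => ?_⟩
        simp only [add_right_comm y (Pi.single l 1), BinState.next_some _ _ _ _ hl,
          BinState.reward_some _ _ _ hl]
        rw [add_right_comm y]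
        linarith [ih1 (y + Pi.single (BinState.addSize l u hl) 1) ξ k]
    · intro x u k k' hk
      rw [← add_zero (dpValue _ _ ⟨x + Pi.single k 1, u⟩)]
      refine dpValue_le_of_forall hP fun a => ?_
      rcases BinState.action_cases (x + Pi.single k' 1) u a with
        rfl | ⟨l, rfl, hl⟩ | ⟨l, y, rfl, hy, hl⟩
      · refine ⟨none, fun ξ => ?_⟩
        simp only [BinState.next_none, BinState.reward_none, add_right_comm x _ (Pi.single u 1)]
        linarith [ih2 (x + Pi.single u 1) ξ k k' hk]
      · refine ⟨none, fun ξ => ?_⟩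
        simp only [BinState.next_none, BinState.reward_none, BinState.reward_of_not_fits hl,
          BinState.next_of_not_fits hl]
        linarith [ih2 x ξ k k' hk, ih1 (x + Pi.single k 1) ξ u]
      · rcases eq_or_ne l k' with rfl | hne
        · have hku : (k : ℕ) + u ≤ B := le_trans (Nat.add_le_add_right hk _) hl
          refine ⟨some k, fun ξ => ?_⟩
          rw [BinState.next_some _ _ _ _ hl, BinState.next_some _ _ _ _ hku,
            BinState.reward_some _ _ _ hl, BinState.reward_some _ _ _ hku]
          have := ih2 x ξ (BinState.addSize k u hku) (BinState.addSize l u hl)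
            (Nat.add_le_add_right hk _)
          linarith
        · obtain ⟨w, rfl⟩ : ∃ w : BinSize B → ℕ, x = w + Pi.single l 1 := by
            have hf : BinState.Fits ⟨x, u⟩ l := by
              refine ⟨?_, hl⟩
              have := congrFun hy l
              simp only [Pi.add_apply, Pi.single_eq_same, Pi.single_eq_of_ne hne] at this
              change 0 < x l
              omega
            exact (BinState.fits_iff.1 hf).1
          refine ⟨some l, fun ξ => ?_⟩
          simp only [add_right_comm w (Pi.single l 1), BinState.next_some _ _ _ _ hl,
            BinState.reward_some _ _ _ hl]
          rw [add_right_comm w, add_right_comm w _ (Pi.single (BinState.addSize l u hl) 1)]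
          linarith [ih2 (w + Pi.single (BinState.addSize l u hl) 1) ξ k k' hk]

variable {P : Fin n → BinSize B → ℝ}

theorem dpValue_le_add_bin (hP : ∀ i, P i ∈ stdSimplex ℝ (BinSize B)) (x : BinSize B → ℕ)
    (u k : BinSize B) : dpValue n P ⟨x, u⟩ ≤ dpValue n P ⟨x + Pi.single k 1, u⟩ :=
  (dpValue_mono_aux n P hP).1 x u k

theorem dpValue_antitone_bin (hP : ∀ i, P i ∈ stdSimplex ℝ (BinSize B)) (x : BinSize B → ℕ)
    (u : BinSize B) {k k' : BinSize B} (h : k ≤ k') :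
    dpValue n P ⟨x + Pi.single k' 1, u⟩ ≤ dpValue n P ⟨x + Pi.single k 1, u⟩ :=
  (dpValue_mono_aux n P hP).2 x u k k' h

/-- An additional open bin is worth at most one new bin. -/
theorem dpValue_add_bin_le (n : ℕ) (P : Fin n → BinSize B → ℝ)
    (hP : ∀ i, P i ∈ stdSimplex ℝ (BinSize B)) (x : BinSize B → ℕ) (u k : BinSize B) :
    dpValue n P ⟨x + Pi.single k 1, u⟩ ≤ dpValue n P ⟨x, u⟩ + 1 := by
  induction n generalizing x u k with
  | zero => simp [dpValue]
  | succ n ih =>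
    have hP' : ∀ i, Fin.tail P i ∈ stdSimplex ℝ (BinSize B) := fun i => hP i.succ
    refine dpValue_le_of_forall hP fun a => ?_
    rcases BinState.action_cases (x + Pi.single k 1) u a with
      rfl | ⟨l, rfl, hl⟩ | ⟨l, y, rfl, hy, hl⟩
    · refine ⟨none, fun ξ => ?_⟩
      simp only [BinState.next_none, BinState.reward_none, add_right_comm x _ (Pi.single u 1)]
      linarith [ih (Fin.tail P) hP' (x + Pi.single u 1) ξ k]
    · refine ⟨none, fun ξ => ?_⟩
      simp only [BinState.next_none, BinState.reward_none, BinState.reward_of_not_fits hl,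
        BinState.next_of_not_fits hl]
      linarith [ih (Fin.tail P) hP' x ξ k, dpValue_le_add_bin hP' x ξ u]
    · rcases eq_or_ne l k with rfl | hne
      · refine ⟨none, fun ξ => ?_⟩
        rw [BinState.next_some _ _ _ _ hl, BinState.reward_some _ _ _ hl, BinState.next_none,
          BinState.reward_none]
        have := dpValue_antitone_bin hP' x ξ (k := u) (k' := BinState.addSize l u hl)
          (Nat.le_add_left _ _)
        linarith
      · obtain ⟨w, rfl⟩ : ∃ w : BinSize B → ℕ, x = w + Pi.single l 1 := by
          have hf : BinState.Fits ⟨x, u⟩ l := by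
            refine ⟨?_, hl⟩
            have := congrFun hy l
            simp only [Pi.add_apply, Pi.single_eq_same, Pi.single_eq_of_ne hne] at this
            change 0 < x l
            omega
          exact (BinState.fits_iff.1 hf).1
        refine ⟨some l, fun ξ => ?_⟩
        simp only [add_right_comm w (Pi.single l 1), BinState.next_some _ _ _ _ hl,
          BinState.reward_some _ _ _ hl]
        rw [add_right_comm w]
        linarith [ih (Fin.tail P) hP' (w + Pi.single (BinState.addSize l u hl) 1) ξ k]

theorem dpValue_next_none (hP : ∀ i, P i ∈ stdSimplex ℝ (BinSize B)) (s : BinState B)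
    (ξ : BinSize B) :
    dpValue n P ⟨s.bins, ξ⟩ ≤ dpValue n P (s.next none ξ) ∧
      dpValue n P (s.next none ξ) ≤ dpValue n P ⟨s.bins, ξ⟩ + 1 :=
  ⟨dpValue_le_add_bin hP _ _ _, dpValue_add_bin_le n P hP _ _ _⟩

theorem dpValue_next_some (hP : ∀ i, P i ∈ stdSimplex ℝ (BinSize B)) (s : BinState B)
    (k ξ : BinSize B) :
    dpValue n P (s.next (some k) ξ) ≤ dpValue n P ⟨s.bins, ξ⟩ ∧
      dpValue n P ⟨s.bins, ξ⟩ ≤ dpValue n P (s.next (some k) ξ) + 1 := by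
  obtain ⟨x, u⟩ := s
  rcases BinState.action_cases x u (some k) with h | ⟨l, h, hl⟩ | ⟨l, y, h, rfl, hl⟩
  · simp at h
  · obtain rfl := Option.some.inj h
    simp [BinState.next_of_not_fits hl]
  · obtain rfl := Option.some.inj h
    rw [BinState.next_some _ _ _ _ hl]
    exact ⟨dpValue_antitone_bin hP _ _ (Nat.le_add_right _ _),
      (dpValue_add_bin_le n P hP _ _ _).trans
        (by linarith [dpValue_le_add_bin hP y ξ (BinState.addSize k u hl)])⟩

end DynamicProgram

/-! ### Expectations over i.i.d. traces. -/

section TraceExpectation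

variable {B : ℕ} {p : BinSize B → ℝ}

theorem traceExp_succ (p : BinSize B → ℝ) (n : ℕ) (g : (Fin (n + 1) → BinSize B) → ℝ) :
    traceExp p (n + 1) g =
      ∑ ξ₀, p ξ₀ * traceExp p n fun ξ => g (Fin.cons (α := fun _ => BinSize B) ξ₀ ξ) := by
  simp only [traceExp]
  rw [← (Fin.consEquiv fun _ : Fin (n + 1) => BinSize B).sum_comp, Fintype.sum_prod_type]
  simp [Fin.prod_univ_succ, Finset.mul_sum, mul_assoc, Fin.consEquiv]

theorem traceExp_zero (p : BinSize B → ℝ) (g : (Fin 0 → BinSize B) → ℝ) :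
    traceExp p 0 g = g Fin.elim0 := by
  simp [traceExp, Subsingleton.elim default (Fin.elim0 : Fin 0 → BinSize B)]

theorem traceExp_add (n : ℕ) (f g : (Fin n → BinSize B) → ℝ) :
    traceExp p n (fun ξ => f ξ + g ξ) = traceExp p n f + traceExp p n g := by
  simp [traceExp, mul_add, Finset.sum_add_distrib]

theorem traceExp_const_mul (n : ℕ) (c : ℝ) (f : (Fin n → BinSize B) → ℝ) :
    traceExp p n (fun ξ => c * f ξ) = c * traceExp p n f := by
  simp [traceExp, Finset.mul_sum, mul_left_comm]

theorem traceExp_sum {α : Type*} (s : Finset α) (n : ℕ) (f : α → (Fin n → BinSize B) → ℝ) :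
    traceExp p n (fun ξ => ∑ i ∈ s, f i ξ) = ∑ i ∈ s, traceExp p n (f i) := by
  simp only [traceExp, Finset.mul_sum]
  exact Finset.sum_comm

theorem traceExp_mono (hp : p ∈ stdSimplex ℝ (BinSize B)) {n : ℕ}
    {f g : (Fin n → BinSize B) → ℝ} (h : ∀ ξ, f ξ ≤ g ξ) : traceExp p n f ≤ traceExp p n g :=
  Finset.sum_le_sum fun ξ _ =>
    mul_le_mul_of_nonneg_left (h ξ) (Finset.prod_nonneg fun i _ => hp.1 (ξ i))

theorem traceExp_prod (n : ℕ) (f : BinSize B → ℝ) :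
    traceExp p n (fun ξ => ∏ i, f (ξ i)) = (∑ j, p j * f j) ^ n := by
  induction n with
  | zero => simp [traceExp_zero]
  | succ n ih =>
    simp only [traceExp_succ, Fin.prod_univ_succ, Fin.cons_zero, Fin.cons_succ,
      traceExp_const_mul, ih]
    rw [pow_succ', Finset.sum_mul]
    simp [mul_assoc]

theorem traceExp_const (hp : p ∈ stdSimplex ℝ (BinSize B)) (n : ℕ) (c : ℝ) :
    traceExp p n (fun _ => c) = c := by
  have := traceExp_prod (p := p) n fun _ => 1
  simp only [Finset.prod_const_one, mul_one, hp.2, one_pow] at this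
  simpa [this] using traceExp_const_mul (p := p) n c fun _ => 1

theorem traceExp_const_add (hp : p ∈ stdSimplex ℝ (BinSize B)) (n : ℕ) (c : ℝ)
    (f : (Fin n → BinSize B) → ℝ) : traceExp p n (fun ξ => c + f ξ) = c + traceExp p n f := by
  rw [traceExp_add n (fun _ => c), traceExp_const hp]

theorem sum_mul_const_add (hp : p ∈ stdSimplex ℝ (BinSize B)) (c : ℝ) (f : BinSize B → ℝ) :
    ∑ ξ, p ξ * (c + f ξ) = c + ∑ ξ, p ξ * f ξ := by
  simp only [mul_add, Finset.sum_add_distrib, ← Finset.sum_mul, hp.2, one_mul]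

end TraceExpectation

/-! ### Bellman equations and the bound on the hindsight bias. -/

section DynamicProgrammingValues

variable {B : ℕ} {p : BinSize B → ℝ}

theorem openLoopReturn_le_hindsight {n : ℕ} (s : BinState B) (a : Fin n → BinAction B)
    (ξ : Fin n → BinSize B) : openLoopReturn n s a ξ ≤ hindsight n s ξ :=
  le_ciSup (f := fun a => openLoopReturn n s a ξ) (Set.finite_range _).bddAbove a

theorem exists_hindsight_eq {n : ℕ} (s : BinState B) (ξ : Fin n → BinSize B) :
    ∃ a, hindsight n s ξ = openLoopReturn n s a ξ := by
  obtain ⟨a, ha⟩ := exists_eq_ciSup_of_finite (f := fun a => openLoopReturn n s a ξ)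
  exact ⟨a, ha.symm⟩

theorem hindsight_zero (s : BinState B) (ξ : Fin 0 → BinSize B) : hindsight 0 s ξ = 0 := by
  obtain ⟨a, ha⟩ := exists_hindsight_eq s ξ
  rw [ha, openLoopReturn]

theorem hindsight_ge {n : ℕ} (s : BinState B) (ξ : Fin (n + 1) → BinSize B) (a : BinAction B) :
    s.reward a + hindsight n (s.next a (ξ 0)) (Fin.tail ξ) ≤ hindsight (n + 1) s ξ := by
  obtain ⟨b, hb⟩ := exists_hindsight_eq (s.next a (ξ 0)) (Fin.tail ξ)
  rw [hb]
  exact openLoopReturn_le_hindsight s (Fin.cons a b : Fin (n + 1) → BinAction B) ξ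

theorem exists_hindsight_succ_eq {n : ℕ} (s : BinState B) (ξ : Fin (n + 1) → BinSize B) :
    ∃ a, hindsight (n + 1) s ξ = s.reward a + hindsight n (s.next a (ξ 0)) (Fin.tail ξ) := by
  obtain ⟨b, hb⟩ := exists_hindsight_eq s ξ
  refine ⟨b 0, le_antisymm ?_ (hindsight_ge s ξ (b 0))⟩
  rw [hb, openLoopReturn]
  exact add_le_add_right (openLoopReturn_le_hindsight _ _ _) _

/-- The hindsight value is the optimal value for deterministic inputs. -/
theorem hindsight_eq_dpValue {n : ℕ} (s : BinState B) (ξ : Fin n → BinSize B) :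
    hindsight n s ξ = dpValue n (fun i => Pi.single (ξ i) 1) s := by
  induction n generalizing s with
  | zero => rw [hindsight_zero, dpValue]
  | succ n ih =>
    have hstep : ∀ a, s.reward a + hindsight n (s.next a (ξ 0)) (Fin.tail ξ) =
        s.reward a + ∑ ξ', (Pi.single (ξ 0) 1 : BinSize B → ℝ) ξ' *
          dpValue n (Fin.tail (α := fun _ => BinSize B → ℝ) fun i => Pi.single (ξ i) 1)
            (s.next a ξ') := by
      intro a
      simp [ih, Pi.single_apply, Fin.tail_def]
    refine le_antisymm ?_ (ciSup_le fun a => (hstep a).symm.le.trans (hindsight_ge s ξ a))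
    obtain ⟨a, ha⟩ := exists_hindsight_succ_eq s ξ
    rw [ha, hstep]
    exact dpValue_ge (fun i => Pi.single (ξ i) 1) s a

theorem hindsight_next_none {n : ℕ} (s : BinState B) (ξ₀ : BinSize B) (ξ : Fin n → BinSize B) :
    hindsight n ⟨s.bins, ξ₀⟩ ξ ≤ hindsight n (s.next none ξ₀) ξ ∧
      hindsight n (s.next none ξ₀) ξ ≤ hindsight n ⟨s.bins, ξ₀⟩ ξ + 1 := by
  simp only [hindsight_eq_dpValue]
  exact dpValue_next_none (fun i => single_mem_stdSimplex ℝ (ξ i)) s ξ₀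

theorem hindsight_next_some {n : ℕ} (s : BinState B) (k ξ₀ : BinSize B)
    (ξ : Fin n → BinSize B) :
    hindsight n (s.next (some k) ξ₀) ξ ≤ hindsight n ⟨s.bins, ξ₀⟩ ξ ∧
      hindsight n ⟨s.bins, ξ₀⟩ ξ ≤ hindsight n (s.next (some k) ξ₀) ξ + 1 := by
  simp only [hindsight_eq_dpValue]
  exact dpValue_next_some (fun i => single_mem_stdSimplex ℝ (ξ i)) s k ξ₀

theorem BinState.reward_nonpos (s : BinState B) (a : BinAction B) : s.reward a ≤ 0 := by
  rcases a with _ | k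
  · simp [reward]
  · simp only [reward]; split_ifs <;> norm_num

theorem BinState.neg_hundred_le_reward (s : BinState B) (a : BinAction B) :
    -100 ≤ s.reward a := by
  rcases a with _ | k
  · norm_num [reward]
  · simp only [reward]; split_ifs <;> norm_num

theorem hindsight_succ_le_none {n : ℕ} (s : BinState B) (ξ : Fin (n + 1) → BinSize B) :
    hindsight (n + 1) s ξ ≤ hindsight n (s.next none (ξ 0)) (Fin.tail ξ) := by
  obtain ⟨a, ha⟩ := exists_hindsight_succ_eq s ξ
  have h1 := s.reward_nonpos a
  have h2 := hindsight_next_none s (ξ 0) (Fin.tail ξ)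
  rcases a with _ | k
  · linarith
  · linarith [hindsight_next_some s k (ξ 0) (Fin.tail ξ)]

/-- A single action, even an infeasible one, loses a bounded amount against the hindsight
planner. -/
theorem hindsight_succ_le {n : ℕ} (s : BinState B) (ξ : Fin (n + 1) → BinSize B)
    (a : BinAction B) :
    hindsight (n + 1) s ξ ≤ s.reward a + hindsight n (s.next a (ξ 0)) (Fin.tail ξ) + 102 := by
  have h0 := hindsight_succ_le_none s ξ
  have h1 := s.neg_hundred_le_reward a
  have h2 := hindsight_next_none s (ξ 0) (Fin.tail ξ)
  rcases a with _ | k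
  · linarith
  · linarith [hindsight_next_some s k (ξ 0) (Fin.tail ξ)]

theorem traceValue_le_hindsight (π : MarkovPolicy B) (t n : ℕ) (s : BinState B)
    (ξ : Fin n → BinSize B) : traceValue π t n s ξ ≤ hindsight n s ξ := by
  induction n generalizing t s with
  | zero => rw [hindsight_zero, traceValue]
  | succ n ih =>
    rw [traceValue]
    have h := stdSimplex_expectation_le (π t s).2 (c := hindsight (n + 1) s ξ) (g := fun _ => 0)
      (f := fun a => s.reward a + traceValue π (t + 1) n (s.next a (ξ 0)) (Fin.tail ξ))
      fun a => by linarith [hindsight_ge s ξ a, ih (t + 1) (s.next a (ξ 0)) (Fin.tail ξ)]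
    simp only [mul_zero, Finset.sum_const_zero, zero_add] at h
    exact h

theorem traceExp_traceValue_succ (hp : p ∈ stdSimplex ℝ (BinSize B)) (π : MarkovPolicy B)
    (t n : ℕ) (s : BinState B) :
    traceExp p (n + 1) (traceValue π t (n + 1) s) =
      ∑ a, (π t s : BinAction B → ℝ) a * (s.reward a +
        ∑ ξ, p ξ * traceExp p n (traceValue π (t + 1) n (s.next a ξ))) := by
  simp only [traceValue, traceExp_sum, traceExp_const_mul]
  refine Finset.sum_congr rfl fun a _ => ?_
  rw [traceExp_const_add hp, traceExp_succ]
  simp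

theorem DetPolicy.traceExp_traceValue_succ (hp : p ∈ stdSimplex ℝ (BinSize B)) (π : DetPolicy B)
    (t n : ℕ) (s : BinState B) :
    traceExp p (n + 1) (traceValue π.toMarkov t (n + 1) s) = s.reward (π t s) +
        ∑ ξ, p ξ * traceExp p n (traceValue π.toMarkov (t + 1) n (s.next (π t s) ξ)) := by
  rw [_root_.traceExp_traceValue_succ hp]
  simp [toMarkov, Pi.single_apply]

theorem traceExp_traceValue_le_dpValue (hp : p ∈ stdSimplex ℝ (BinSize B)) (π : MarkovPolicy B)
    (t n : ℕ) (s : BinState B) :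
    traceExp p n (traceValue π t n s) ≤ dpValue n (fun _ => p) s := by
  induction n generalizing t s with
  | zero => simp [traceExp_zero, traceValue, dpValue]
  | succ n ih =>
    rw [traceExp_traceValue_succ hp]
    have h := stdSimplex_expectation_le (π t s).2 (c := dpValue (n + 1) (fun _ => p) s)
      (g := fun _ => 0) (f := fun a => s.reward a +
        ∑ ξ, p ξ * traceExp p n (traceValue π (t + 1) n (s.next a ξ))) fun a => by
      have h1 := dpValue_ge (n := n) (fun _ => p) s a
      have h2 := stdSimplex_expectation_le hp (c := 0) fun ξ =>
        (ih (t + 1) (s.next a ξ)).trans (add_zero _).ge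
      simp only [Fin.tail_def] at h1
      linarith
    simp only [mul_zero, Finset.sum_const_zero, zero_add] at h
    exact h

/-- A policy that attains the optimal value of the dynamic program. -/
theorem exists_greedy (hp : p ∈ stdSimplex ℝ (BinSize B)) (T : ℕ) :
    ∃ π : DetPolicy B, ∀ n t, t + n = T + 1 → ∀ s,
      traceExp p n (traceValue π.toMarkov t n s) = dpValue n (fun _ => p) s := by
  choose g hg using fun (n : ℕ) (s : BinState B) => exists_dpValue_eq (n := n) (fun _ => p) s
  refine ⟨fun t s => g (T - t) s, fun n => ?_⟩
  induction n with
  | zero => intro t _ s; simp [traceExp_zero, traceValue, dpValue]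
  | succ n ih =>
    intro t ht s
    rw [DetPolicy.traceExp_traceValue_succ hp, hg]
    obtain rfl : T - t = n := by omega
    simp only [ih (t + 1) (by omega)]
    rfl

theorem IsOptimalPolicy.policyV_eq (hp : p ∈ stdSimplex ℝ (BinSize B)) {T : ℕ}
    {opt : DetPolicy B} (hopt : IsOptimalPolicy p T opt) {t n : ℕ} (ht : 1 ≤ t)
    (htn : t + n = T + 1) (s : BinState B) :
    traceExp p n (traceValue opt.toMarkov t n s) = dpValue n (fun _ => p) s := by
  refine le_antisymm (traceExp_traceValue_le_dpValue hp _ _ _ _) ?_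
  -- No remaining period means `t = T + 1`, which `IsOptimalPolicy` does not cover; both sides
  -- vanish there.
  rcases n with _ | n
  · simp [traceExp_zero, traceValue, dpValue]
  · obtain ⟨π, hπ⟩ := exists_greedy hp T
    have h := hopt t (Finset.mem_Icc.2 ⟨ht, by omega⟩) s π.toMarkov
    rw [← hπ _ t htn, show n + 1 = T + 1 - t by omega]
    exact h

theorem policyQ_eq (hp : p ∈ stdSimplex ℝ (BinSize B)) {T : ℕ}
    {opt : DetPolicy B} (hopt : IsOptimalPolicy p T opt) {t : ℕ} (ht : t ∈ Finset.Icc 1 T)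
    (s : BinState B) (a : BinAction B) :
    policyQ p T opt.toMarkov t s a =
      s.reward a + ∑ ξ, p ξ * dpValue (T - t) (fun _ => p) (s.next a ξ) := by
  rw [Finset.mem_Icc] at ht
  rw [policyQ, traceExp_const_add hp, traceExp_succ]
  simp only [Fin.cons_zero, Fin.tail_cons]
  simp only [← IsOptimalPolicy.policyV_eq hp hopt (t := t + 1) (n := T - t) (by omega) (by omega)]

theorem hindsightQ_eq (hp : p ∈ stdSimplex ℝ (BinSize B)) (T t : ℕ)
    (s : BinState B) (a : BinAction B) :
    hindsightQ p T t s a =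
      s.reward a + ∑ ξ, p ξ * traceExp p (T - t) (hindsight (T - t) (s.next a ξ)) := by
  rw [hindsightQ, traceExp_const_add hp, traceExp_succ]
  simp only [Fin.cons_zero, Fin.tail_cons]

theorem hindsightBias_le_two (hp : p ∈ stdSimplex ℝ (BinSize B)) {T : ℕ} (dag : DetPolicy B)
    {opt : DetPolicy B} (hopt : IsOptimalPolicy p T opt) {t : ℕ} (ht : t ∈ Finset.Icc 1 T)
    (s : BinState B) : hindsightBias p T dag opt t s ≤ 2 := by
  rw [hindsightBias, policyQ_eq hp hopt ht, policyQ_eq hp hopt ht, hindsightQ_eq hp,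
    hindsightQ_eq hp]
  generalize dag t s = a
  generalize opt t s = b
  set n := T - t
  have hH : ∀ {x y : BinSize B → BinState B} {c : ℝ},
      (∀ ξ₀ ξ, hindsight n (x ξ₀) ξ ≤ hindsight n (y ξ₀) ξ + c) →
      ∑ ξ, p ξ * traceExp p n (hindsight n (x ξ)) ≤
        ∑ ξ, p ξ * traceExp p n (hindsight n (y ξ)) + c := by
    intro x y c h
    refine stdSimplex_expectation_le hp fun ξ₀ => (traceExp_mono hp (h ξ₀)).trans ?_
    rw [traceExp_add, traceExp_const hp]
  have hV : ∀ {x y : BinSize B → BinState B} {c : ℝ},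
      (∀ ξ, dpValue n (fun _ => p) (x ξ) ≤ dpValue n (fun _ => p) (y ξ) + c) →
      ∑ ξ, p ξ * dpValue n (fun _ => p) (x ξ) ≤
        ∑ ξ, p ξ * dpValue n (fun _ => p) (y ξ) + c :=
    fun h => stdSimplex_expectation_le hp h
  have hP : ∀ _ : Fin n, p ∈ stdSimplex ℝ (BinSize B) := fun _ => hp
  -- After the rewards cancel, the bias is at most `c + d`. Opening versus not opening costs 2 in
  -- one of the two value functions and nothing in the other; two placements cost at most 1 in each.
  have key : ∀ a b : BinAction B, ∃ c d : ℝ, c + d ≤ 2 ∧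
      (∀ ξ₀ ξ, hindsight n (s.next a ξ₀) ξ ≤ hindsight n (s.next b ξ₀) ξ + c) ∧
      (∀ ξ, dpValue n (fun _ => p) (s.next b ξ) ≤ dpValue n (fun _ => p) (s.next a ξ) + d) := by
    intro a b
    rcases a with _ | k <;> rcases b with _ | l
    · exact ⟨0, 0, by norm_num, by simp, by simp⟩
    · refine ⟨2, 0, by norm_num, fun ξ₀ ξ => ?_, fun ξ => ?_⟩
      · linarith [hindsight_next_none s ξ₀ ξ, hindsight_next_some s l ξ₀ ξ]
      · linarith [dpValue_next_none hP s ξ, dpValue_next_some hP s l ξ]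
    · refine ⟨0, 2, by norm_num, fun ξ₀ ξ => ?_, fun ξ => ?_⟩
      · linarith [hindsight_next_none s ξ₀ ξ, hindsight_next_some s k ξ₀ ξ]
      · linarith [dpValue_next_none hP s ξ, dpValue_next_some hP s k ξ]
    · refine ⟨1, 1, by norm_num, fun ξ₀ ξ => ?_, fun ξ => ?_⟩
      · linarith [hindsight_next_some s k ξ₀ ξ, hindsight_next_some s l ξ₀ ξ]
      · linarith [dpValue_next_some hP s k ξ, dpValue_next_some hP s l ξ]
  obtain ⟨c, d, hcd, h1, h2⟩ := key a b
  linarith [hH h1, hV h2]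

end DynamicProgrammingValues

/-! ### Hindsight planning as an integer program over bin patterns. -/

section Packing

variable {B : ℕ}

/-- The utilization of the bin that an action uses, before the item is added. -/
def BinAction.load (a : BinAction B) : ℕ := a.elim 0 fun ℓ => (ℓ : ℕ)

/-- The open bins that an action uses. -/
def BinAction.bin : BinAction B → BinSize B → ℕ
  | none => 0
  | some ℓ => Pi.single ℓ 1

/-- The number of new bins that an action opens. -/
def BinAction.cost : BinAction B → ℕ
  | none => 1
  | some _ => 0

/-- The utilization, after the item `u` has been added, of the bin that an action uses. -/
def BinAction.filled (a : BinAction B) (u : BinSize B) (h : a.load + u ≤ B) : BinSize B :=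
  ⟨a.load + u, Finset.mem_Icc.2 ⟨le_add_left (Finset.mem_Icc.1 u.2).1, h⟩⟩

theorem BinState.next_of_feasible (y : BinSize B → ℕ) (u ξ : BinSize B) (a : BinAction B)
    (h : a.load + u ≤ B) :
    next ⟨y + a.bin, u⟩ a ξ = ⟨y + Pi.single (a.filled u h) 1, ξ⟩ := by
  rcases a with _ | k
  · rw [next_none]
    congr 3
    exact Subtype.ext (Nat.zero_add _).symm
  · exact next_some y u k ξ h

theorem BinState.reward_of_feasible (y : BinSize B → ℕ) (u : BinSize B) (a : BinAction B)
    (h : a.load + u ≤ B) : reward ⟨y + a.bin, u⟩ a = -a.cost := by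
  rcases a with _ | k
  · simp [reward, BinAction.cost]
  · have : reward ⟨y + BinAction.bin (some k), u⟩ (some k) = 0 := reward_some y u k h
    simp [this, BinAction.cost]

/-- The ways to use a single bin: the initial utilization of the bin (`none` for a new one), and
how many items of each size are put into it. -/
abbrev PackingPattern (B : ℕ) : Type :=
  {q : BinAction B × (BinSize B → ℕ) // q.1.load + ∑ j : BinSize B, (j : ℕ) * q.2 j ≤ B}

theorem PackingPattern.content_le (q : PackingPattern B) (j : BinSize B) : q.1.2 j ≤ B := by
  have h1 : (j : ℕ) * q.1.2 j ≤ ∑ j : BinSize B, (j : ℕ) * q.1.2 j :=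
    Finset.single_le_sum (f := fun j : BinSize B => (j : ℕ) * q.1.2 j)
      (fun _ _ => Nat.zero_le _) (Finset.mem_univ j)
  have h2 : q.1.2 j ≤ (j : ℕ) * q.1.2 j := Nat.le_mul_of_pos_left _ (Finset.mem_Icc.1 j.2).1
  have := q.2
  omega

instance : Finite (PackingPattern B) := by
  refine ((Set.finite_univ (α := BinAction B)).prod
    (Set.finite_Iic fun _ : BinSize B => B)).subset ?_
  exact fun q hq => ⟨Set.mem_univ _, fun j => PackingPattern.content_le ⟨q, hq⟩ j⟩

noncomputable instance : Fintype (PackingPattern B) := Fintype.ofFinite _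

noncomputable instance : DecidableEq (PackingPattern B) := Classical.decEq _

/-- The integer program of bin packing: its rows count the open bins and the items. -/
def packingMatrix (B : ℕ) : Matrix (BinSize B ⊕ BinSize B) (PackingPattern B) ℕ :=
  fun k q => Sum.elim q.1.1.bin q.1.2 k

/-- The number of new bins that a pattern uses. -/
def packingCost (B : ℕ) (q : PackingPattern B) : ℕ := q.1.1.cost

theorem packingMatrix_mulVec_single (q : PackingPattern B) :
    packingMatrix B *ᵥ Pi.single q 1 = Sum.elim q.1.1.bin q.1.2 := by
  rw [mulVec_single_one]; rfl

theorem packingMatrix_mulVec_inl (z : PackingPattern B → ℕ) (k : BinSize B) :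
    (packingMatrix B *ᵥ z) (Sum.inl k) = ∑ q : PackingPattern B, q.1.1.bin k * z q := rfl

theorem packingMatrix_mulVec_inr (z : PackingPattern B → ℕ) (j : BinSize B) :
    (packingMatrix B *ᵥ z) (Sum.inr j) = ∑ q : PackingPattern B, q.1.2 j * z q := rfl

theorem packingCost_add_single (z : PackingPattern B → ℕ) (q : PackingPattern B) :
    packingCost B ⬝ᵥ (z + Pi.single q 1) = packingCost B ⬝ᵥ z + q.1.1.cost := by
  rw [dotProduct_add, dotProduct_single_one]; rfl

theorem exists_eq_add_single {α : Type*} [DecidableEq α] {z : α → ℕ} {i : α} (h : z i ≠ 0) :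
    ∃ w : α → ℕ, z = w + Pi.single i 1 := by
  refine ⟨z - Pi.single i 1, ?_⟩
  ext k
  rcases eq_or_ne k i with rfl | hk
  · simp only [Pi.add_apply, Pi.sub_apply, Pi.single_eq_same]; omega
  · simp [hk]

/-- The items that have to be packed in `n` periods if the current item is `u`. -/
def demand : (n : ℕ) → BinSize B → (Fin n → BinSize B) → BinSize B → ℕ
  | 0, _, _ => 0
  | n + 1, u, ξ => demand n (ξ 0) (Fin.tail ξ) + Pi.single u 1

theorem sum_mul_add_single (c : BinSize B → ℕ) (u : BinSize B) :
    ∑ j : BinSize B, (j : ℕ) * (c + Pi.single u 1 : BinSize B → ℕ) j = ∑ j : BinSize B, (j : ℕ) * c j + u := by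
  simp [mul_add, Finset.sum_add_distrib, Pi.single_apply]

/-- Undoing an action in a packing. -/
theorem exists_packing_of_feasible {y d : BinSize B → ℕ} {u : BinSize B} {a : BinAction B}
    (h : a.load + u ≤ B) {z : PackingPattern B → ℕ}
    (hz : packingMatrix B *ᵥ z = Sum.elim (y + Pi.single (a.filled u h) 1) d) :
    ∃ z', packingMatrix B *ᵥ z' = Sum.elim (y + a.bin) (d + Pi.single u 1) ∧
      packingCost B ⬝ᵥ z' = packingCost B ⬝ᵥ z + a.cost := by
  have hpos : ∑ q : PackingPattern B, q.1.1.bin (a.filled u h) * z q ≠ 0 := by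
    rw [← packingMatrix_mulVec_inl z (a.filled u h), hz]; simp
  -- Some pattern in `z` starts from the bin just filled. It is replaced by one that starts from the
  -- bin used by `a` and contains one more `u`.
  obtain ⟨⟨⟨b, c⟩, hq⟩, -, hne⟩ := Finset.exists_ne_zero_of_sum_ne_zero hpos
  obtain rfl : b = some (a.filled u h) := by
    rcases b with _ | k
    · simp [BinAction.bin] at hne
    · by_contra hk
      have hk : a.filled u h ≠ k := fun h' => hk (by rw [h'])
      simp [BinAction.bin, hk] at hne
  obtain ⟨w, rfl⟩ := exists_eq_add_single (right_ne_zero_of_mul hne)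
  have hq' : a.load + ∑ j : BinSize B, (j : ℕ) * (c + Pi.single u 1 : BinSize B → ℕ) j ≤ B := by
    rw [sum_mul_add_single, add_comm _ (u : ℕ), ← add_assoc]
    exact hq
  refine ⟨w + Pi.single ⟨(a, c + Pi.single u 1), hq'⟩ 1, ?_, ?_⟩
  · rw [mulVec_add, packingMatrix_mulVec_single] at hz ⊢
    ext (k | j)
    · have := congrFun hz (Sum.inl k)
      simp only [Pi.add_apply, Sum.elim_inl, BinAction.bin] at this ⊢
      omega
    · have := congrFun hz (Sum.inr j)
      simp only [Pi.add_apply, Sum.elim_inr] at this ⊢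
      omega
  · rw [packingCost_add_single, packingCost_add_single]; rfl

/-- Executing the part of a packing that concerns an item. -/
theorem exists_packing_after {x d : BinSize B → ℕ} {u : BinSize B} {z : PackingPattern B → ℕ}
    (hz : packingMatrix B *ᵥ z = Sum.elim x (d + Pi.single u 1)) {q : PackingPattern B}
    (hzq : z q ≠ 0) (hq : q.1.2 u ≠ 0) :
    ∃ (h : q.1.1.load + u ≤ B) (y : BinSize B → ℕ) (z' : PackingPattern B → ℕ),
      x = y + q.1.1.bin ∧
      packingMatrix B *ᵥ z' = Sum.elim (y + Pi.single (q.1.1.filled u h) 1) d ∧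
      packingCost B ⬝ᵥ z = packingCost B ⬝ᵥ z' + q.1.1.cost := by
  obtain ⟨⟨a, c⟩, hac⟩ := q
  obtain ⟨c, rfl⟩ := exists_eq_add_single hq
  obtain ⟨w, rfl⟩ := exists_eq_add_single hzq
  have hac' := hac
  simp only [sum_mul_add_single] at hac'
  have h : a.load + u ≤ B := by omega
  rw [mulVec_add, packingMatrix_mulVec_single] at hz
  have hl : ∀ k, (packingMatrix B *ᵥ w) (Sum.inl k) + a.bin k = x k :=
    fun k => congrFun hz (Sum.inl k)
  have hr : ∀ j, (packingMatrix B *ᵥ w) (Sum.inr j) + c j = d j := by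
    intro j
    have := congrFun hz (Sum.inr j)
    simp only [Pi.add_apply, Sum.elim_inr] at this
    omega
  -- Conversely, the pattern now starts from the filled bin and contains one `u` fewer.
  have hq' : BinAction.load (some (a.filled u h)) + ∑ j : BinSize B, (j : ℕ) * c j ≤ B := by
    change a.load + u + _ ≤ B
    omega
  refine ⟨h, fun k => (packingMatrix B *ᵥ w) (Sum.inl k),
    w + Pi.single ⟨(some (a.filled u h), c), hq'⟩ 1, funext fun k => (hl k).symm, ?_, ?_⟩
  · rw [mulVec_add, packingMatrix_mulVec_single]
    ext (k | j)
    · rfl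
    · exact hr j
  · rw [packingCost_add_single, packingCost_add_single]; rfl

/-- The constraints are equations, so idle open bins must be covered too: empty patterns do this at
no cost. -/
theorem exists_packing_zero (x : BinSize B → ℕ) :
    ∃ z, packingMatrix B *ᵥ z = Sum.elim x 0 ∧ packingCost B ⬝ᵥ z = 0 := by
  have hq : ∀ k : BinSize B, BinAction.load (some k) + ∑ j : BinSize B, (j : ℕ) *
      (0 : BinSize B → ℕ) j ≤ B := fun k => by
    simpa [BinAction.load] using (Finset.mem_Icc.1 k.2).2
  refine ⟨∑ k : BinSize B, x k • Pi.single (⟨(some k, 0), hq k⟩ : PackingPattern B) 1, ?_, ?_⟩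
  · rw [mulVec_sum]
    simp only [mulVec_smul, packingMatrix_mulVec_single]
    ext (k | j)
    · simp [BinAction.bin, Finset.sum_apply, Pi.single_apply]
    · simp [Finset.sum_apply]
  · rw [dotProduct_sum]
    refine Finset.sum_eq_zero fun k _ => ?_
    rw [dotProduct_smul, dotProduct_single_one]
    exact smul_zero _

theorem BinState.feasible_or (x : BinSize B → ℕ) (u : BinSize B) (a : BinAction B) :
    (∃ y, x = y + a.bin ∧ a.load + u ≤ B) ∨
      reward ⟨x, u⟩ a = -100 ∧ ∀ ξ, next ⟨x, u⟩ a ξ = ⟨x, ξ⟩ := by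
  rcases action_cases x u a with rfl | ⟨k, rfl, h⟩ | ⟨k, y, rfl, hy, h⟩
  · exact Or.inl ⟨x, rfl, (Nat.zero_add _).le.trans (Finset.mem_Icc.1 u.2).2⟩
  · exact Or.inr ⟨reward_of_not_fits h, next_of_not_fits h⟩
  · exact Or.inl ⟨y, hy, h⟩

/-- Every action sequence yields a packing that is at least as good. -/
theorem exists_packing_of_openLoop (n : ℕ) (s : BinState B) (a : Fin n → BinAction B)
    (ξ : Fin n → BinSize B) :
    ∃ z, packingMatrix B *ᵥ z = Sum.elim s.bins (demand n s.item ξ) ∧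
      ((packingCost B ⬝ᵥ z : ℕ) : ℝ) ≤ -openLoopReturn n s a ξ := by
  induction n generalizing s with
  | zero =>
    obtain ⟨z, hz, h0⟩ := exists_packing_zero s.bins
    exact ⟨z, hz, by simp [h0, openLoopReturn]⟩
  | succ n ih =>
    obtain ⟨z, hz, hc⟩ := ih (s.next (a 0) (ξ 0)) (Fin.tail a) (Fin.tail ξ)
    obtain ⟨x, u⟩ := s
    rw [openLoopReturn]
    rcases BinState.feasible_or x u (a 0) with ⟨y, rfl, h⟩ | ⟨hr, hnext⟩
    · rw [BinState.next_of_feasible _ _ _ _ h] at hz hc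
      obtain ⟨z', hz', hc'⟩ := exists_packing_of_feasible h hz
      refine ⟨z', hz', ?_⟩
      rw [hc', BinState.next_of_feasible _ _ _ _ h, BinState.reward_of_feasible _ _ _ h]
      push_cast
      linarith
    · rw [hnext] at hz hc
      have hz₁ : packingMatrix B *ᵥ z = Sum.elim x (demand n (ξ 0) (Fin.tail ξ)) := hz
      have hu : (u : ℕ) ≤ B := (Finset.mem_Icc.1 u.2).2
      have hq : BinAction.load (none : BinAction B) + ∑ j : BinSize B, (j : ℕ) *
          (Pi.single u 1 : BinSize B → ℕ) j ≤ B := by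
        simpa [BinAction.load, Pi.single_apply] using hu
      -- An infeasible action leaves `u` unpacked; the packing gives it a bin of its own, at cost 1
      -- instead of 100.
      refine ⟨z + Pi.single ⟨(none, Pi.single u 1), hq⟩ 1, ?_, ?_⟩
      · rw [mulVec_add, hz₁, packingMatrix_mulVec_single]
        ext (k | j)
        · simp [BinAction.bin]
        · simp [demand]
      · rw [hnext, hr]
        rw [packingCost_add_single, BinAction.cost]
        push_cast
        linarith

theorem exists_packing_le_hindsight (n : ℕ) (s : BinState B) (ξ : Fin n → BinSize B) :
    ∃ z, packingMatrix B *ᵥ z = Sum.elim s.bins (demand n s.item ξ) ∧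
      hindsight n s ξ ≤ -((packingCost B ⬝ᵥ z : ℕ) : ℝ) := by
  obtain ⟨a, ha⟩ := exists_hindsight_eq s ξ
  obtain ⟨z, hz, hc⟩ := exists_packing_of_openLoop n s a ξ
  exact ⟨z, hz, by rw [ha]; linarith⟩

theorem exists_packing_next {n : ℕ} {s : BinState B} {ξ : Fin (n + 1) → BinSize B}
    {z : PackingPattern B → ℕ}
    (hz : packingMatrix B *ᵥ z = Sum.elim s.bins (demand (n + 1) s.item ξ))
    {q : PackingPattern B} (hzq : z q ≠ 0) (hq : q.1.2 s.item ≠ 0) :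
    ∃ z', packingMatrix B *ᵥ z' = Sum.elim (s.next q.1.1 (ξ 0)).bins
        (demand n (s.next q.1.1 (ξ 0)).item (Fin.tail ξ)) ∧
      -((packingCost B ⬝ᵥ z : ℕ) : ℝ) = s.reward q.1.1 - ((packingCost B ⬝ᵥ z' : ℕ) : ℝ) := by
  obtain ⟨x, u⟩ := s
  obtain ⟨h, y, z', hy, hz', hc⟩ := exists_packing_after hz hzq hq
  change x = _ at hy
  subst hy
  refine ⟨z', ?_, ?_⟩
  · rw [BinState.next_of_feasible _ _ _ _ h]; exact hz'
  · rw [BinState.reward_of_feasible _ _ _ h, hc]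
    push_cast
    ring

/-- A packing can be executed in order of arrival: the current item always lies in some pattern of
positive multiplicity, which dictates the action. -/
theorem neg_packingCost_le_hindsight (n : ℕ) (s : BinState B) (ξ : Fin n → BinSize B)
    {z : PackingPattern B → ℕ}
    (hz : packingMatrix B *ᵥ z = Sum.elim s.bins (demand n s.item ξ)) :
    -((packingCost B ⬝ᵥ z : ℕ) : ℝ) ≤ hindsight n s ξ := by
  induction n generalizing s z with
  | zero => rw [hindsight_zero]; simp
  | succ n ih =>
    have hpos : ∑ q : PackingPattern B, q.1.2 s.item * z q ≠ 0 := by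
      rw [← packingMatrix_mulVec_inr z s.item, hz]; simp [demand]
    obtain ⟨q, -, hne⟩ := Finset.exists_ne_zero_of_sum_ne_zero hpos
    obtain ⟨z', hz', hc⟩ :=
      exists_packing_next hz (right_ne_zero_of_mul hne) (left_ne_zero_of_mul hne)
    have h1 := ih _ _ hz'
    have h2 := hindsight_ge s ξ q.1.1
    linarith

/-- An action that an optimal packing uses for an item of the current size loses nothing. -/
theorem hindsight_succ_le_of_isIPOptimal {n : ℕ} {s : BinState B} {ξ : Fin (n + 1) → BinSize B}
    {z : PackingPattern B → ℕ} (hz : (packingMatrix B).IsIPOptimal (packingCost B)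
      (Sum.elim s.bins (demand (n + 1) s.item ξ)) z)
    {q : PackingPattern B} (hzq : z q ≠ 0) (hq : q.1.2 s.item ≠ 0) :
    hindsight (n + 1) s ξ ≤
      s.reward q.1.1 + hindsight n (s.next q.1.1 (ξ 0)) (Fin.tail ξ) := by
  obtain ⟨w, hw, hle⟩ := exists_packing_le_hindsight (n + 1) s ξ
  have hcw : ((packingCost B ⬝ᵥ z : ℕ) : ℝ) ≤ ((packingCost B ⬝ᵥ w : ℕ) : ℝ) :=
    Nat.cast_le.2 (hz.2 w hw)
  obtain ⟨z', hz', hc⟩ := exists_packing_next hz.1 hzq hq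
  linarith [neg_packingCost_le_hindsight _ _ _ hz']

/-- Some action loses nothing on all traces close to a reference trace. -/
theorem exists_action_hindsight_stable (B : ℕ) :
    ∃ K : ℕ, ∀ (n : ℕ) (s : BinState B) (ξ' : Fin (n + 1) → BinSize B),
      ∃ a : BinAction B, ∀ ξ : Fin (n + 1) → BinSize B,
        K * ∑ j, ((demand (n + 1) s.item ξ' j - demand (n + 1) s.item ξ j) +
          (demand (n + 1) s.item ξ j - demand (n + 1) s.item ξ' j)) <
            demand (n + 1) s.item ξ' s.item →
        hindsight (n + 1) s ξ ≤ s.reward a + hindsight n (s.next a (ξ 0)) (Fin.tail ξ) := by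
  obtain ⟨K, hK⟩ := (packingMatrix B).exists_isIPOptimal_near (packingCost B)
  refine ⟨Fintype.card (PackingPattern B) * B * K, fun n s ξ' => ?_⟩
  obtain ⟨w', hw', -⟩ := exists_packing_le_hindsight (n + 1) s ξ'
  obtain ⟨z', hz'⟩ := exists_isIPOptimal (packingCost B) hw'
  have hpos : demand (n + 1) s.item ξ' s.item ≠ 0 := by simp [demand]
  have hsum : demand (n + 1) s.item ξ' s.item =
      ∑ q : PackingPattern B, q.1.2 s.item * z' q := by
    rw [← packingMatrix_mulVec_inr z' s.item, hz'.1, Sum.elim_inr]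
  obtain ⟨q₀, -, -⟩ := Finset.exists_ne_zero_of_sum_ne_zero (hsum ▸ hpos)
  -- Pigeonhole: one pattern packs at least the average share of the items of the current size.
  obtain ⟨q, -, hq⟩ := Finset.exists_max_image Finset.univ
    (fun q : PackingPattern B => q.1.2 s.item * z' q) ⟨q₀, Finset.mem_univ _⟩
  have hle : demand (n + 1) s.item ξ' s.item ≤
      Fintype.card (PackingPattern B) * (q.1.2 s.item * z' q) := by
    rw [hsum, ← smul_eq_mul]
    exact Finset.sum_le_card_nsmul _ _ _ hq
  have hqs : q.1.2 s.item ≠ 0 := by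
    intro h0
    simp only [h0, zero_mul, mul_zero] at hle
    omega
  refine ⟨q.1.1, fun ξ hξ => ?_⟩
  obtain ⟨w, hw, -⟩ := exists_packing_le_hindsight (n + 1) s ξ
  obtain ⟨z, hz, hnear⟩ := hK _ _ z' w hz' hw
  refine hindsight_succ_le_of_isIPOptimal hz (fun h0 => ?_) hqs
  -- If `q` vanished from `z`, then `z' q` would be at most `K` times the change in demand, since
  -- the open bins agree. With at most `B` copies per pattern this contradicts `hξ`.
  have h1 := hnear q
  simp only [h0, zero_add, Fintype.sum_sum_type, Sum.elim_inl, Sum.elim_inr, tsub_self,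
    Finset.sum_const_zero] at h1
  refine absurd hξ (not_lt.2 (hle.trans ?_))
  rw [mul_assoc, mul_assoc]
  exact Nat.mul_le_mul_left _ (Nat.mul_le_mul (q.content_le _) h1)

end Packing

/-! ### Chernoff bounds for the empirical frequencies. -/

section Concentration

variable {B : ℕ} {p : BinSize B → ℝ}

/-- The number of items of size `j` in a trace. -/
noncomputable def traceCount {n : ℕ} (ξ : Fin n → BinSize B) (j : BinSize B) : ℝ :=
  ∑ i, if ξ i = j then 1 else 0

/-- The last entry of the trace is revealed after the last action and is never packed; the current
item is packed but is not in the trace. -/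
theorem demand_succ_eq (n : ℕ) (u : BinSize B) (ξ : Fin (n + 1) → BinSize B) (j : BinSize B) :
    (demand (n + 1) u ξ j : ℝ) + (if ξ (Fin.last n) = j then 1 else 0) =
      (if u = j then 1 else 0) + traceCount ξ j := by
  induction n generalizing u with
  | zero =>
    rw [traceCount, Fin.sum_univ_succ]
    simp [demand, Pi.single_apply, eq_comm (a := j)]
  | succ n ih =>
    have h := ih (ξ 0) (Fin.tail ξ)
    have hlast : Fin.tail ξ (Fin.last n) = ξ (Fin.last (n + 1)) := rfl
    have hcount : traceCount ξ j = (if ξ 0 = j then 1 else 0) + traceCount (Fin.tail ξ) j := by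
      rw [traceCount, Fin.sum_univ_succ]; rfl
    rw [hlast] at h
    rw [hcount, ← h, demand, Pi.add_apply, Pi.single_apply]
    push_cast
    simp only [eq_comm (a := j)]
    ring

theorem traceCount_le_demand {n : ℕ} (u : BinSize B) (ξ : Fin (n + 1) → BinSize B) :
    traceCount ξ u ≤ demand (n + 1) u ξ u := by
  have h := demand_succ_eq n u ξ u
  rw [if_pos rfl] at h
  have : (if ξ (Fin.last n) = u then 1 else 0 : ℝ) ≤ 1 := by split_ifs <;> norm_num
  linarith

theorem abs_demand_sub_le {n : ℕ} (u : BinSize B) (ξ ξ' : Fin (n + 1) → BinSize B)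
    (j : BinSize B) :
    |(demand (n + 1) u ξ j : ℝ) - demand (n + 1) u ξ' j| ≤
      |traceCount ξ j - traceCount ξ' j| + 1 := by
  have h := demand_succ_eq n u ξ j
  have h' := demand_succ_eq n u ξ' j
  have hd : (demand (n + 1) u ξ j : ℝ) - demand (n + 1) u ξ' j =
      (traceCount ξ j - traceCount ξ' j) + ((if ξ' (Fin.last n) = j then 1 else 0) -
        if ξ (Fin.last n) = j then 1 else 0) := by linarith
  rw [hd]
  refine (abs_add_le _ _).trans (add_le_add_right ?_ _)
  split_ifs <;> norm_num

/-- For `|x| ≤ 1` one has `exp x ≤ 1 + x + x ^ 2`; the linear term has mean zero, and `1 + θ ^ 2 ≤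
exp (θ ^ 2)`. -/
theorem sum_mul_exp_centered_le (hp : p ∈ stdSimplex ℝ (BinSize B)) (j : BinSize B) {θ : ℝ}
    (hθ : |θ| ≤ 1) :
    ∑ k, p k * Real.exp (θ * ((if k = j then 1 else 0) - p j)) ≤ Real.exp (θ ^ 2) := by
  have hpj : p j ≤ 1 := by
    rw [← hp.2]; exact Finset.single_le_sum (fun i _ => hp.1 i) (Finset.mem_univ j)
  have hmean : ∑ k, p k * (θ * ((if k = j then 1 else 0) - p j)) = 0 := by
    have : ∀ k, p k * (θ * ((if k = j then 1 else 0) - p j)) =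
        θ * (p k * (if k = j then 1 else 0)) - θ * p j * p k := fun k => by ring
    simp only [this, Finset.sum_sub_distrib, ← Finset.mul_sum, hp.2]
    simp
  have hterm : ∀ k, Real.exp (θ * ((if k = j then 1 else 0) - p j)) ≤
      θ * ((if k = j then 1 else 0) - p j) + (1 + θ ^ 2) := by
    intro k
    have habs : |((if k = j then 1 else 0) - p j : ℝ)| ≤ 1 := by
      have := hp.1 j
      rw [abs_le]
      split_ifs <;> constructor <;> linarith
    have hx : |θ * ((if k = j then 1 else 0) - p j)| ≤ |θ| := by
      rw [abs_mul]
      exact mul_le_of_le_one_right (abs_nonneg _) habs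
    have h1 := (abs_le.1 (Real.abs_exp_sub_one_sub_id_le (hx.trans hθ))).2
    have h2 := sq_le_sq.2 hx
    linarith
  have h := stdSimplex_expectation_le hp hterm
  rw [hmean] at h
  linarith [Real.add_one_le_exp (θ ^ 2)]

theorem traceExp_exp_count_le (hp : p ∈ stdSimplex ℝ (BinSize B)) (j : BinSize B) {θ : ℝ}
    (hθ : |θ| ≤ 1) (n : ℕ) :
    traceExp p n (fun ξ => Real.exp (θ * (traceCount ξ j - n * p j))) ≤
      Real.exp (θ ^ 2) ^ n := by
  have h : ∀ ξ : Fin n → BinSize B, Real.exp (θ * (traceCount ξ j - n * p j)) =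
      ∏ i, Real.exp (θ * ((if ξ i = j then 1 else 0) - p j)) := by
    intro ξ
    rw [← Real.exp_sum, ← Finset.mul_sum, Finset.sum_sub_distrib]
    simp [traceCount]
  simp only [h]
  rw [traceExp_prod n fun k => Real.exp (θ * ((if k = j then 1 else 0) - p j))]
  exact pow_le_pow_left₀ (Finset.sum_nonneg fun k _ => mul_nonneg (hp.1 k) (Real.exp_pos _).le)
    (sum_mul_exp_centered_le hp j hθ) n

/-- An exponential upper bound for the indicator of the traces that have, for some item size, an
empirical frequency that is off by more than `ε`. -/
noncomputable def deviation (p : BinSize B → ℝ) (ε : ℝ) {n : ℕ} (ξ : Fin n → BinSize B) : ℝ :=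
  ∑ j, Real.exp (-(ε ^ 2 * n / 2)) * (Real.exp (ε / 2 * (traceCount ξ j - n * p j)) +
    Real.exp (-(ε / 2) * (traceCount ξ j - n * p j)))

theorem deviation_nonneg (p : BinSize B → ℝ) (ε : ℝ) {n : ℕ} (ξ : Fin n → BinSize B) :
    0 ≤ deviation p ε ξ :=
  Finset.sum_nonneg fun _ _ => by positivity

theorem one_le_deviation {ε : ℝ} (hε : 0 < ε) {n : ℕ} {ξ : Fin n → BinSize B} {j : BinSize B}
    (h : ε * n < |traceCount ξ j - n * p j|) : 1 ≤ deviation p ε ξ := by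
  refine le_trans ?_ (Finset.single_le_sum (f := fun j => Real.exp (-(ε ^ 2 * n / 2)) *
    (Real.exp (ε / 2 * (traceCount ξ j - n * p j)) +
      Real.exp (-(ε / 2) * (traceCount ξ j - n * p j)))) (fun _ _ => by positivity)
    (Finset.mem_univ j))
  set x := traceCount ξ j - n * p j
  have h1 : 1 ≤ Real.exp (-(ε ^ 2 * n / 2)) * Real.exp (ε / 2 * |x|) := by
    rw [← Real.exp_add, Real.one_le_exp_iff]
    nlinarith
  refine h1.trans (mul_le_mul_of_nonneg_left ?_ (Real.exp_pos _).le)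
  rcases abs_cases x with ⟨hx, -⟩ | ⟨hx, -⟩ <;> rw [hx]
  · exact le_add_of_nonneg_right (Real.exp_pos _).le
  · rw [mul_neg, ← neg_mul]
    exact le_add_of_nonneg_left (Real.exp_pos _).le

theorem traceExp_deviation_le (hp : p ∈ stdSimplex ℝ (BinSize B)) {ε : ℝ} (hε : 0 < ε)
    (hε1 : ε ≤ 1) (n : ℕ) :
    traceExp p n (deviation p ε) ≤
      2 * Fintype.card (BinSize B) * Real.exp (-(ε ^ 2 / 4)) ^ n := by
  have hθ : |ε / 2| ≤ 1 := by rw [abs_of_pos (by positivity)]; linarith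
  have hθ' : |-(ε / 2)| ≤ 1 := by rwa [abs_neg]
  have hexp : Real.exp (-(ε ^ 2 * n / 2)) * Real.exp ((ε / 2) ^ 2) ^ n =
      Real.exp (-(ε ^ 2 / 4)) ^ n := by
    rw [← Real.exp_nat_mul, ← Real.exp_nat_mul, ← Real.exp_add]
    congr 1
    ring
  change traceExp p n (fun ξ => deviation p ε ξ) ≤ _
  simp only [deviation, traceExp_sum, traceExp_const_mul, traceExp_add]
  have hj : ∀ j ∈ Finset.univ, Real.exp (-(ε ^ 2 * n / 2)) *
      (traceExp p n (fun ξ => Real.exp (ε / 2 * (traceCount ξ j - n * p j))) +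
        traceExp p n (fun ξ => Real.exp (-(ε / 2) * (traceCount ξ j - n * p j)))) ≤
      2 * Real.exp (-(ε ^ 2 / 4)) ^ n := by
    intro j _
    have h1 := traceExp_exp_count_le hp j hθ n
    have h2 := traceExp_exp_count_le hp j hθ' n
    rw [neg_sq] at h2
    rw [← hexp, mul_left_comm]
    exact mul_le_mul_of_nonneg_left (by linarith) (Real.exp_pos _).le
  refine (Finset.sum_le_card_nsmul _ _ _ hj).trans (le_of_eq ?_)
  rw [nsmul_eq_mul, Finset.card_univ]
  ring

end Concentration

/-! ### From one-step losses to bounded regret. -/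

section Regret

variable {B : ℕ} {p : BinSize B → ℝ}

/-- If the empirical frequencies are close to `p`, then some action loses nothing. -/
theorem exists_action_of_frequencies (p : BinSize B → ℝ) {δ : ℝ} (hδ : 0 < δ) :
    ∃ ε : ℝ, 0 < ε ∧ ε ≤ 1 ∧ ∀ (n : ℕ) (s : BinState B), δ ≤ p s.item → 1 ≤ ε * (n + 1 : ℕ) →
      ∃ a : BinAction B, ∀ ξ : Fin (n + 1) → BinSize B,
        (∀ j, |traceCount ξ j - (n + 1 : ℕ) * p j| ≤ ε * (n + 1 : ℕ)) →
        hindsight (n + 1) s ξ ≤ s.reward a + hindsight n (s.next a (ξ 0)) (Fin.tail ξ) := by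
  obtain ⟨K, hK⟩ := exists_action_hindsight_stable B
  set N := Fintype.card (BinSize B) with hN
  have hM : (0 : ℝ) < 3 * K * N + 2 := by positivity
  -- With `m = n + 1` and `1 ≤ ε m`, demands of two typical traces differ by at most `2 ε m + 1 ≤ 3
  -- ε m` per size, while the current size has demand at least `(δ - ε) m`. The 2 in the denominator
  -- makes the required inequality strict.
  refine ⟨min 1 (δ / (3 * K * N + 2)), lt_min one_pos (by positivity), min_le_left _ _,
    fun n s hs hn => ?_⟩
  set ε := min 1 (δ / (3 * K * N + 2)) with hε
  have hε0 : 0 < ε := lt_min one_pos (by positivity)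
  have hεδ : ε * (3 * K * N + 2) ≤ δ := (le_div_iff₀ hM).1 (min_le_right _ _)
  set m : ℝ := ((n + 1 : ℕ) : ℝ) with hm
  have hm0 : 0 < m := by positivity
  by_cases hgood : ∃ ξ' : Fin (n + 1) → BinSize B, ∀ j, |traceCount ξ' j - m * p j| ≤ ε * m
  · obtain ⟨ξ', hξ'⟩ := hgood
    obtain ⟨a, ha⟩ := hK n s ξ'
    refine ⟨a, fun ξ hξ => ha ξ ?_⟩
    rw [← Nat.cast_lt (α := ℝ), Nat.cast_mul, Nat.cast_sum]
    have hterm : ∀ j ∈ Finset.univ, (((demand (n + 1) s.item ξ' j - demand (n + 1) s.item ξ j) +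
        (demand (n + 1) s.item ξ j - demand (n + 1) s.item ξ' j) : ℕ) : ℝ) ≤ 3 * (ε * m) := by
      intro j _
      have h1 : (((demand (n + 1) s.item ξ' j - demand (n + 1) s.item ξ j) +
          (demand (n + 1) s.item ξ j - demand (n + 1) s.item ξ' j) : ℕ) : ℝ) =
          |(demand (n + 1) s.item ξ' j : ℝ) - demand (n + 1) s.item ξ j| := by
        rcases le_total (demand (n + 1) s.item ξ' j) (demand (n + 1) s.item ξ j) with h | h
        · rw [Nat.sub_eq_zero_of_le h, zero_add, Nat.cast_sub h, abs_sub_comm, abs_of_nonneg]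
          exact sub_nonneg.2 (Nat.cast_le.2 h)
        · rw [Nat.sub_eq_zero_of_le h, add_zero, Nat.cast_sub h, abs_of_nonneg]
          exact sub_nonneg.2 (Nat.cast_le.2 h)
      have h2 := abs_demand_sub_le s.item ξ' ξ j
      have h3 : |traceCount ξ' j - traceCount ξ j| ≤ ε * m + ε * m := by
        have := abs_sub_le (traceCount ξ' j) (m * p j) (traceCount ξ j)
        rw [abs_sub_comm (m * p j)] at this
        linarith [hξ' j, hξ j]
      rw [h1]
      linarith
    have hsum := Finset.sum_le_card_nsmul _ _ _ hterm
    rw [nsmul_eq_mul, Finset.card_univ, ← hN] at hsum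
    have hu := traceCount_le_demand s.item ξ'
    have hlow := (abs_le.1 (hξ' s.item)).1
    have hps : m * δ ≤ m * p s.item := mul_le_mul_of_nonneg_left hs hm0.le
    have hKs := mul_le_mul_of_nonneg_left hsum (Nat.cast_nonneg (α := ℝ) K)
    have hεm := mul_le_mul_of_nonneg_left hεδ hm0.le
    have hpos : 0 < ε * m := mul_pos hε0 hm0
    nlinarith
  · exact ⟨none, fun ξ hξ => absurd ⟨ξ, hξ⟩ hgood⟩

/-- In every state some action has an exponentially small expected loss against the hindsight
planner, uniformly over the states. -/
theorem exists_action_expected_loss_le (hp : p ∈ stdSimplex ℝ (BinSize B)) :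
    ∃ C r : ℝ, 0 ≤ C ∧ 0 ≤ r ∧ r < 1 ∧ ∀ (n : ℕ) (s : BinState B), p s.item ≠ 0 →
      ∃ a : BinAction B, traceExp p (n + 1) (hindsight (n + 1) s) ≤
        traceExp p (n + 1) (fun ξ =>
          s.reward a + hindsight n (s.next a (ξ 0)) (Fin.tail ξ)) + C * r ^ (n + 1) := by
  -- A common lower bound for the finitely many positive probabilities.
  obtain ⟨δ, hδp, hδ⟩ : ∃ δ : ℝ, (∀ u, p u ≠ 0 → δ ≤ p u) ∧ 0 < δ := by
    have h : ∀ᶠ δ in nhdsWithin (0 : ℝ) (Set.Ioi 0), ∀ u, p u ≠ 0 → δ ≤ p u := by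
      refine Filter.eventually_all.2 fun u => ?_
      by_cases hu : p u = 0
      · exact Filter.Eventually.of_forall fun _ h => absurd hu h
      · filter_upwards [Ioc_mem_nhdsGT (lt_of_le_of_ne (hp.1 u) (Ne.symm hu))] with δ hδ _
        exact hδ.2
    exact (h.and self_mem_nhdsWithin).exists
  obtain ⟨ε, hε0, hε1, hε⟩ := exists_action_of_frequencies p hδ
  set r := Real.exp (-(ε ^ 2 / 4)) with hr
  set N := Fintype.card (BinSize B)
  -- The term `2 * N` pays for atypical traces. The term `Real.exp 1` pays for short horizons, `ε (n
  -- + 1) < 1`, where `r ^ (n + 1)` exceeds `exp (-1)`.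
  refine ⟨102 * (2 * N + Real.exp 1), r, by positivity, (Real.exp_pos _).le,
    Real.exp_lt_one_iff.2 (by have := sq_pos_of_pos hε0; linarith), fun n s hs => ?_⟩
  have hr0 : 0 ≤ r ^ (n + 1) := by positivity
  rcases le_or_gt 1 (ε * (n + 1 : ℕ)) with hn | hn
  · obtain ⟨a, ha⟩ := hε n s (hδp _ hs) hn
    refine ⟨a, ?_⟩
    have hpt : ∀ ξ : Fin (n + 1) → BinSize B, hindsight (n + 1) s ξ ≤
        (s.reward a + hindsight n (s.next a (ξ 0)) (Fin.tail ξ)) + 102 * deviation p ε ξ := by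
      intro ξ
      by_cases hξ : ∀ j, |traceCount ξ j - (n + 1 : ℕ) * p j| ≤ ε * (n + 1 : ℕ)
      · linarith [ha ξ hξ, deviation_nonneg p ε ξ]
      · push Not at hξ
        obtain ⟨j, hj⟩ := hξ
        linarith [hindsight_succ_le s ξ a, one_le_deviation hε0 hj]
    refine (traceExp_mono hp hpt).trans ?_
    rw [traceExp_add, traceExp_const_mul]
    have h1 := traceExp_deviation_le hp hε0 hε1 (n + 1)
    have h2 : 0 ≤ Real.exp 1 * r ^ (n + 1) := by positivity
    linarith
  · refine ⟨none, ?_⟩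
    refine (traceExp_mono hp fun ξ => hindsight_succ_le s ξ none).trans ?_
    rw [traceExp_add _ (fun ξ => s.reward none + hindsight n (s.next none (ξ 0)) (Fin.tail ξ)),
      traceExp_const hp]
    have h1 : 1 ≤ Real.exp 1 * r ^ (n + 1) := by
      rw [hr, ← Real.exp_nat_mul, ← Real.exp_add, Real.one_le_exp_iff]
      nlinarith
    have h2 : 0 ≤ (N : ℝ) * r ^ (n + 1) := by positivity
    linarith

/-- The expectation in the hypothesis is the hindsight Q-value of `a`, which `dag t s` maximizes; so
any comparison action bounds its loss. -/
theorem hindsight_le_hindsightPolicy_step (hp : p ∈ stdSimplex ℝ (BinSize B)) {T : ℕ}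
    {dag : DetPolicy B} (hdag : IsHindsightPolicy p T dag) {t n : ℕ} (ht : 1 ≤ t)
    (htn : t + n = T) {s : BinState B} {a : BinAction B} {c : ℝ}
    (h : traceExp p (n + 1) (hindsight (n + 1) s) ≤ traceExp p (n + 1) (fun ξ =>
      s.reward a + hindsight n (s.next a (ξ 0)) (Fin.tail ξ)) + c) :
    traceExp p (n + 1) (hindsight (n + 1) s) ≤ s.reward (dag t s) +
      ∑ ξ, p ξ * traceExp p n (hindsight n (s.next (dag t s) ξ)) + c := by
  have hmax := hdag t (Finset.mem_Icc.2 ⟨ht, by omega⟩) s a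
  rw [hindsightQ_eq hp T t s (dag t s)] at hmax
  obtain rfl : n = T - t := by omega
  rw [hindsightQ] at hmax
  linarith

theorem BinState.next_item (s : BinState B) (a : BinAction B) (ξ : BinSize B) :
    (s.next a ξ).item = ξ := by
  rcases a with _ | k
  · rfl
  · rw [next]; split_ifs <;> rfl

/-- Next items of probability zero carry no weight, so a bound for current items in the support of
`p` is enough. -/
theorem expected_hindsight_next_le (hp : p ∈ stdSimplex ℝ (BinSize B)) {n t : ℕ}
    {π : MarkovPolicy B} {c : ℝ} (h : ∀ s : BinState B, p s.item ≠ 0 →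
      traceExp p n (hindsight n s) ≤ traceExp p n (traceValue π t n s) + c)
    (s : BinState B) (a : BinAction B) :
    ∑ ξ, p ξ * traceExp p n (hindsight n (s.next a ξ)) ≤
      c + ∑ ξ, p ξ * traceExp p n (traceValue π t n (s.next a ξ)) := by
  rw [← sum_mul_const_add hp]
  refine Finset.sum_le_sum fun ξ _ => ?_
  by_cases hξ : p ξ = 0
  · simp [hξ]
  · rw [add_comm c]
    exact mul_le_mul_of_nonneg_left (h _ (by rwa [s.next_item])) (hp.1 ξ)

theorem hindsight_le_hindsightPolicy (hp : p ∈ stdSimplex ℝ (BinSize B)) {β : ℕ → ℝ}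
    (hβ : ∀ (n : ℕ) (s : BinState B), p s.item ≠ 0 →
      ∃ a : BinAction B, traceExp p (n + 1) (hindsight (n + 1) s) ≤
        traceExp p (n + 1) (fun ξ =>
          s.reward a + hindsight n (s.next a (ξ 0)) (Fin.tail ξ)) + β n)
    {T : ℕ} {dag : DetPolicy B} (hdag : IsHindsightPolicy p T dag) (n : ℕ) {t : ℕ} (ht : 1 ≤ t)
    (htn : t + n = T + 1) (s : BinState B) (hs : p s.item ≠ 0) :
    traceExp p n (hindsight n s) ≤
      traceExp p n (traceValue dag.toMarkov t n s) + ∑ k ∈ Finset.range n, β k := by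
  induction n generalizing t s with
  | zero => simp [traceExp_zero, hindsight_zero, traceValue]
  | succ n ih =>
    obtain ⟨a, ha⟩ := hβ n s hs
    have hstep := hindsight_le_hindsightPolicy_step hp hdag ht (by omega) ha
    rw [DetPolicy.traceExp_traceValue_succ hp, Finset.sum_range_succ]
    have hnext := expected_hindsight_next_le hp
      (fun s' hs' => ih (t := t + 1) (by omega) (by omega) s' hs') s (dag t s)
    linarith

theorem exists_regret_bound (hp : p ∈ stdSimplex ℝ (BinSize B)) :
    ∃ C : ℝ, ∀ (T : ℕ) (dag opt : DetPolicy B), IsHindsightPolicy p T dag →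
      ∀ s : BinState B, regret p T opt dag.toMarkov s ≤ C := by
  obtain ⟨C, r, hC, hr0, hr1, hloss⟩ := exists_action_expected_loss_le hp
  have hsum : Summable fun k : ℕ => C * r ^ (k + 1) :=
    ((summable_nat_add_iff 1).2 (summable_geometric_of_lt_one hr0 hr1)).mul_left C
  have hnn : ∀ k : ℕ, 0 ≤ C * r ^ (k + 1) := fun k => by positivity
  -- The 102 pays for the first period: the starting item may have probability zero, and then the
  -- geometric bound is not available.
  refine ⟨∑' k : ℕ, C * r ^ (k + 1) + 102, fun T dag opt hdag s => ?_⟩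
  have hopt : policyV p T opt.toMarkov 1 s ≤ traceExp p T (hindsight T s) :=
    traceExp_mono hp fun ξ => traceValue_le_hindsight _ _ _ _ _
  have hV : policyV p T dag.toMarkov 1 s = traceExp p T (traceValue dag.toMarkov 1 T s) := rfl
  rw [regret, hV]
  rcases T with _ | n
  · have : 0 ≤ ∑' k : ℕ, C * r ^ (k + 1) := tsum_nonneg hnn
    simp only [traceExp_zero, traceValue, hindsight_zero] at hopt ⊢
    linarith
  · have h102 : traceExp p (n + 1) (hindsight (n + 1) s) ≤ traceExp p (n + 1) (fun ξ =>
        s.reward none + hindsight n (s.next none (ξ 0)) (Fin.tail ξ)) + 102 := by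
      refine (traceExp_mono hp fun ξ => hindsight_succ_le s ξ none).trans ?_
      rw [traceExp_add _ (fun ξ => s.reward none + hindsight n (s.next none (ξ 0)) (Fin.tail ξ)),
        traceExp_const hp]
    have hstep := hindsight_le_hindsightPolicy_step hp hdag le_rfl (by omega) h102
    have hle : ∑ k ∈ Finset.range n, C * r ^ (k + 1) ≤ ∑' k : ℕ, C * r ^ (k + 1) :=
      hsum.sum_le_tsum _ fun k _ => hnn k
    have hnext := expected_hindsight_next_le hp (fun s' hs' =>
      hindsight_le_hindsightPolicy hp hloss hdag n (t := 2) (by omega) (by omega) s' hs')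
      s (dag 1 s)
    rw [DetPolicy.traceExp_traceValue_succ hp]
    linarith

end Regret

theorem mainTheorem2 (B : ℕ) (p : BinSize B → ℝ) (hp : p ∈ stdSimplex ℝ (BinSize B)) :
    (∀ (T : ℕ) (dag opt : DetPolicy B),
      IsHindsightPolicy p T dag → IsOptimalPolicy p T opt →
        ∀ t ∈ Finset.Icc 1 T, ∀ s : BinState B, hindsightBias p T dag opt t s ≤ 3) ∧
    (∃ C : ℝ, ∀ (T : ℕ) (dag opt : DetPolicy B),
      IsHindsightPolicy p T dag → IsOptimalPolicy p T opt →
        ∀ s₁ : BinState B, regret p T opt dag.toMarkov s₁ ≤ C) := by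
  refine ⟨fun T dag opt _ hopt t ht s =>
    (hindsightBias_le_two hp dag hopt ht s).trans (by norm_num), ?_⟩
  obtain ⟨C, hC⟩ := exists_regret_bound hp
  exact ⟨C, fun T dag opt hdag _ s => hC T dag opt hdag s⟩
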